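/- Stars. Let $(X,x_0)$ be a based metric space. For $W\subseteq X$ and $C\ge 0$ put $H(W,C)=\{z\in X : d(z,W)\le d(z,x_0)+C\}$. Embed $X$ into the space $C(X,\mathbb R)$ of continuous functions with the compact-open topology by $x\mapsto f_x$, $f_x(z)=d(x,z)-d(x,x_0)$; let $\overline X$ be the closure of the image and $\partial X=\overline X\setminus X$ the horofunction boundary. The star of $\xi\in\partial X$ is $$S(\xi)=\overline{\bigcup_{C\ge 0}\ \bigcap_{U}\ \overline{H(U\cap X,C)}}\subseteq\overline X,$$ where $U$ runs over the neighbourhoods of $\xi$ in $\overline X$ and closures are taken in $\overline X$. The graph $DL_3(q)$. Let $q\ge 2$ and let $T$ be the regular $(q+1)$-valent tree in which every vertex has one predecessor and $q$ successors, and any two vertices $v,w$ have a greatest common ancestor $v\curlywedge w$. For each vertex the edges to its successors are labelled by $0,1,\dots,q-1$, and $o\in T$ is a base point such that all edges on the infinite descending path from $o$ are labelled $0$. For $v\in T$ put $l(v)=d(v,o\curlywedge v)$, $m(v)=d(o,o\curlywedge v)$, $h(v)=l(v)-m(v)$. The vertices of $DL_3(q)$ are the triples $v=(v_1,v_2,v_3)$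 of vertices of $T$ with $h(v_1)+h(v_2)+h(v_3)=0$; two vertices $v,w$ are adjacent if there are $i\ne j$ such that $v_i,w_i$ are adjacent in $T$, $v_j,w_j$ are adjacent in $T$, and $v_k=w_k$ for $k\ne i,j$. We regard $DL_3(q)$ as the set of vertices with the graph metric, based at $(o,o,o)$, and write $m_i(v)=m(v_i)$. Let $\alpha_n\in DL_3(q)$ be the point obtained from $(o,o,o)$ by moving up $n$ edges labelled $1$ in the first tree and down $n$ edges in the second, and let $\beta_n$ be the point obtained from $(o,o,o)$ by moving, in the third tree, down $n$ edges and then up $n$ edges labelled $1$. Theorem. Let $q\ge 2$. 1. For every $h\in\partial DL_3(q)$ and $i\in\{1,2,3\}$ there is a unique $m_i(h)\in\mathbb Z_{\ge 0}\cup\{\infty\}$ such that $m_i(x_n)\to m_i(h)$ for every sequence $(x_n)$ in $DL_3(q)$ converging to $h$. 2. The sequences $(\alpha_n)$ and $(\beta_n)$ converge to points $\alpha,\beta\in\partial DL_3(q)$. 3. If $h\in\partial DL_3(q)$ has $m_3(h)=0$, then $h\notin S(\beta)$. 4. In particular $\alpha\notin S(\beta)$, whereas $\beta\in S(\alpha)$;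 so the relation of being contained in the star of another boundary point is not symmetric. -/

import Mathlib

open Filter Topology

/-! ### Stars at infinity -/

/-- The halfspace `H(W, C) = {z | d(z, W) ≤ d(z, x₀) + C}` of a based metric space `(X, x₀)`,
for `W ⊆ X`; the distance to the empty set is `∞`. -/
def halfspace {X : Type*} [MetricSpace X] (x₀ : X) (W : Set X) (C : ℝ) : Set X :=
  {z | Metric.infEDist z W ≤ ENNReal.ofReal (dist z x₀ + C)}

/-- The star of a point `ξ` of a bordification `ι : X → B` of the based metric space `(X, x₀)`.
As neighbourhood basis of `ξ` we take all its neighbourhoods `U` in `B`; the halfspace of `U` is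
that of the set of points of `X` in `U`, and closures are taken in `B`. -/
def karlssonStar {X B : Type*} [MetricSpace X] [TopologicalSpace B] (ι : X → B) (x₀ : X) (ξ : B) :
    Set B :=
  closure (⋃ (C : ℝ) (_ : 0 ≤ C), ⋂ U ∈ 𝓝 ξ, closure (ι '' halfspace x₀ (ι ⁻¹' U) C))

/-! ### The horofunction bordification -/

/-- The function `f_x(z) = d(x, z) - d(x, x₀)`. -/
noncomputable def horoFun {X : Type*} [MetricSpace X] (x₀ x : X) : C(X, ℝ) where
  toFun z := dist x z - dist x x₀
  continuous_toFun := by fun_prop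

/-- The closure `X̄` of `X`, embedded by `x ↦ f_x`, in the continuous functions with the
compact-open topology. (Vanishing at `x₀` is a closed condition, so all functions in `X̄` vanish at
`x₀`, and this is also the closure in the space of continuous functions vanishing at `x₀`.) -/
abbrev HoroClosure {X : Type*} [MetricSpace X] (x₀ : X) : Type _ :=
  closure (Set.range (horoFun x₀))

/-- The embedding of `X` into its horofunction bordification. -/
noncomputable def horoEmbed {X : Type*} [MetricSpace X] (x₀ x : X) : HoroClosure x₀ :=
  ⟨horoFun x₀ x, subset_closure ⟨x, rfl⟩⟩

/-- The horofunction boundary `∂X = X̄ \ X`. -/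
def horoBoundary {X : Type*} [MetricSpace X] (x₀ : X) : Set (HoroClosure x₀) :=
  (Set.range (horoEmbed x₀))ᶜ

/-! ### The tree -/

/-- A vertex of the `(q+1)`-valent tree `T`, in which each vertex has one predecessor and `q`
successors, the edges to the successors being labelled by `0, …, q-1`. A vertex of height `n` is
given by the labels of the edges on the infinite descending path from it: `label k` (for `k < n`) is
the label of the edge from height `k` to height `k + 1`. All but finitely many of them are `0`, and
values of `label` at `k ≥ n` carry no information and are set to `0`. -/
@[ext] structure TreeVertex (q : ℕ) [NeZero q] where
  height : ℤ
  label : ℤ → Fin q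
  label_above : ∀ k, height ≤ k → label k = 0
  label_below : ∃ N, ∀ k < N, label k = 0

namespace TreeVertex

variable {q : ℕ} [NeZero q]

/-- The base point `o`; all edges on the descending path from `o` are labelled `0`. -/
def base : TreeVertex q := ⟨0, fun _ => 0, fun _ _ => rfl, 0, fun _ _ => rfl⟩

/-- The predecessor of a vertex. -/
def pred (v : TreeVertex q) : TreeVertex q where
  height := v.height - 1
  label k := if k < v.height - 1 then v.label k else 0
  label_above k hk := if_neg (by omega)
  label_below := by
    obtain ⟨N, hN⟩ := v.label_below
    exact ⟨N, fun k hk => by simp [hN k hk]⟩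

/-- The successor of a vertex along the edge labelled `a`. -/
def succ (a : Fin q) (v : TreeVertex q) : TreeVertex q where
  height := v.height + 1
  label k := if k = v.height then a else v.label k
  label_above k hk := by
    rw [if_neg (by omega)]
    exact v.label_above k (by omega)
  label_below := by
    obtain ⟨N, hN⟩ := v.label_below
    refine ⟨min N v.height, fun k hk => ?_⟩
    rw [if_neg (by omega)]
    exact hN k (by omega)

theorem pred_succ (a : Fin q) (v : TreeVertex q) : pred (succ a v) = v := by
  ext k
  · simp [pred, succ]
  · by_cases hk : k < v.height
    · simp [pred, succ, hk, hk.ne]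
    · simp [pred, succ, hk, v.label_above k (not_lt.1 hk)]

theorem succ_label_pred (v : TreeVertex q) :
    succ (v.label (v.height - 1)) (pred v) = v := by
  ext k
  · simp [pred, succ]
  · by_cases hk : k = v.height - 1
    · simp [pred, succ, hk]
    · by_cases hk' : k < v.height - 1
      · simp [pred, succ, hk, hk']
      · simp [pred, succ, hk, hk', v.label_above k (by omega)]

theorem height_iterate_pred (n : ℕ) (v : TreeVertex q) :
    (pred^[n] v).height = v.height - n := by
  induction n with
  | zero => simp
  | succ n ih =>
    rw [Function.iterate_succ_apply']
    change (pred^[n] v).height - 1 = _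
    rw [ih]
    push_cast
    ring

theorem height_iterate_succ (a : Fin q) (n : ℕ) (v : TreeVertex q) :
    ((succ a)^[n] v).height = v.height + n := by
  induction n with
  | zero => simp
  | succ n ih =>
    rw [Function.iterate_succ_apply']
    change ((succ a)^[n] v).height + 1 = _
    rw [ih]
    push_cast
    ring

theorem label_iterate_pred (n : ℕ) (v : TreeVertex q) (k : ℤ) :
    (pred^[n] v).label k = if k < v.height - n then v.label k else 0 := by
  induction n with
  | zero =>
    by_cases hk : k < v.height
    · simp [hk]
    · simp [hk, v.label_above k (not_lt.1 hk)]
  | succ n ih =>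
    rw [Function.iterate_succ_apply', pred]
    simp only [height_iterate_pred, ih]
    push_cast
    split_ifs <;> first | rfl | omega

theorem exists_common (v w : TreeVertex q) : ∃ n k : ℕ, pred^[n] v = pred^[k] w := by
  obtain ⟨N, hN⟩ := v.label_below
  obtain ⟨M, hM⟩ := w.label_below
  obtain ⟨L, h1, h2, h3, h4⟩ : ∃ L : ℤ, L ≤ N ∧ L ≤ M ∧ L ≤ v.height ∧ L ≤ w.height :=
    ⟨min (min N M) (min v.height w.height), by omega, by omega, by omega, by omega⟩
  refine ⟨(v.height - L).toNat, (w.height - L).toNat, ?_⟩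
  ext k
  · rw [height_iterate_pred, height_iterate_pred]
    omega
  · rw [label_iterate_pred, label_iterate_pred]
    split_ifs
    · rw [hN k (by omega), hM k (by omega)]
    · omega
    · omega
    · rfl

/-- The ancestor order: `w ≤ v` if `w` is reached from `v` by passing to predecessors. -/
instance : PartialOrder (TreeVertex q) where
  le w v := ∃ n : ℕ, pred^[n] v = w
  le_refl v := ⟨0, rfl⟩
  le_trans := by
    rintro _ _ c ⟨n, rfl⟩ ⟨k, rfl⟩
    exact ⟨n + k, Function.iterate_add_apply _ _ _ _⟩
  le_antisymm := by
    rintro a b ⟨n, hn⟩ ⟨k, hk⟩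
    have h1 := congrArg height hn
    have h2 := congrArg height hk
    rw [height_iterate_pred] at h1 h2
    obtain rfl : n = 0 := by omega
    exact hn.symm

theorem le_def {v w : TreeVertex q} : w ≤ v ↔ ∃ n : ℕ, pred^[n] v = w := Iff.rfl

open Classical in
/-- The greatest common ancestor of `v` and `w` is `v ⊓ w`. -/
noncomputable instance : SemilatticeInf (TreeVertex q) where
  inf v w := pred^[Nat.find (exists_common v w)] v
  inf_le_left v w := ⟨_, rfl⟩
  inf_le_right v w := by
    obtain ⟨k, hk⟩ := Nat.find_spec (exists_common v w)
    exact ⟨k, hk.symm⟩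
  le_inf := by
    rintro u v w ⟨n, rfl⟩ ⟨k, hk⟩
    have hle : Nat.find (exists_common v w) ≤ n := Nat.find_min' _ ⟨k, hk.symm⟩
    exact ⟨n - Nat.find (exists_common v w), by
      rw [← Function.iterate_add_apply, Nat.sub_add_cancel hle]⟩

/-- The tree `T` as a graph. -/
def graph (q : ℕ) [NeZero q] : SimpleGraph (TreeVertex q) where
  Adj v w := pred v = w ∨ pred w = v
  symm := ⟨fun _ _ h => h.symm⟩
  loopless := ⟨fun v h => by
    have h' : pred v = v := h.elim id id
    have := congrArg height h'
    simp [pred] at this⟩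

/-- `m(v) = d(o, o ⋏ v)`. -/
noncomputable def m (v : TreeVertex q) : ℕ := (graph q).dist base (base ⊓ v)

/-- `l(v) = d(v, o ⋏ v)`. -/
noncomputable def l (v : TreeVertex q) : ℕ := (graph q).dist v (base ⊓ v)

/-- `h(v) = l(v) - m(v)`. -/
noncomputable def h (v : TreeVertex q) : ℤ := (l v : ℤ) - (m v : ℤ)

theorem abs_height_sub_le {v w : TreeVertex q} (p : (graph q).Walk v w) :
    |v.height - w.height| ≤ p.length := by
  induction p with
  | nil => simp
  | @cons a b c hab p ih =>
    have h1 : |a.height - b.height| ≤ 1 := by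
      rcases hab with rfl | rfl <;> simp [pred]
    have h2 := abs_sub_le a.height b.height c.height
    rw [SimpleGraph.Walk.length_cons]
    push_cast
    linarith

theorem exists_walk (n : ℕ) (v : TreeVertex q) :
    ∃ p : (graph q).Walk v (pred^[n] v), p.length = n := by
  induction n generalizing v with
  | zero => exact ⟨SimpleGraph.Walk.nil, rfl⟩
  | succ n ih =>
    obtain ⟨p, hp⟩ := ih (pred v)
    have hadj : (graph q).Adj v (pred v) := Or.inl rfl
    exact ⟨SimpleGraph.Walk.cons hadj p, congrArg (· + 1) hp⟩

theorem dist_of_le {v w : TreeVertex q} (hw : w ≤ v) :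
    ((graph q).dist v w : ℤ) = v.height - w.height := by
  obtain ⟨n, rfl⟩ := hw
  obtain ⟨p, hp⟩ := exists_walk n v
  obtain ⟨p', hp'⟩ := p.reachable.exists_walk_length_eq_dist
  have h1 := SimpleGraph.dist_le p
  have h2 := abs_height_sub_le p'
  rw [height_iterate_pred] at *
  have h3 := le_abs_self (v.height - (v.height - (n : ℤ)))
  omega

/-- The function `h` is the height. -/
theorem h_eq_height (v : TreeVertex q) : h v = v.height := by
  have h1 := dist_of_le (inf_le_left : base ⊓ v ≤ base)
  have h2 := dist_of_le (inf_le_right : base ⊓ v ≤ v)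
  have h3 : (base : TreeVertex q).height = 0 := rfl
  rw [h, l, m, h1, h2, h3]
  ring

end TreeVertex

/-! ### Diestel–Leader graphs -/

/-- The vertices of `DL_d(q)`: tuples of vertices of `T` whose heights sum to zero. -/
def DL (d q : ℕ) [NeZero q] : Type :=
  {v : Fin d → TreeVertex q // ∑ i, TreeVertex.h (v i) = 0}

namespace DL

open TreeVertex

variable {d q : ℕ} [NeZero q]

/-- The projection `p_i`. -/
def proj (i : Fin d) (v : DL d q) : TreeVertex q := v.1 i

theorem ext_proj {v w : DL d q} (hvw : ∀ i, proj i v = proj i w) : v = w :=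
  Subtype.ext (funext hvw)

/-- `m_i(v)`. -/
noncomputable def mAt (i : Fin d) (v : DL d q) : ℕ := TreeVertex.m (proj i v)

/-- The graph `DL_d(q)`. -/
def graph (d q : ℕ) [NeZero q] : SimpleGraph (DL d q) where
  Adj v w := ∃ i j, i ≠ j ∧ (TreeVertex.graph q).Adj (proj i v) (proj i w) ∧
    (TreeVertex.graph q).Adj (proj j v) (proj j w) ∧
    ∀ k, k ≠ i → k ≠ j → proj k v = proj k w
  symm := ⟨fun _ _ ⟨i, j, hij, h1, h2, h3⟩ =>
    ⟨i, j, hij, h1.symm, h2.symm, fun k hi hj => (h3 k hi hj).symm⟩⟩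
  loopless := ⟨fun _ ⟨_, _, _, h1, _⟩ => h1.ne rfl⟩

/-- The base point `id = (o, …, o)`. -/
def base : DL d q := ⟨fun _ => TreeVertex.base, by
  simp only [h_eq_height]
  simp [TreeVertex.base]⟩

theorem sum_h_eq {v w : Fin d → TreeVertex q} {i j : Fin d} (hij : i ≠ j) (c : ℤ)
    (hi : (w i).height = (v i).height - c) (hj : (w j).height = (v j).height + c)
    (hk : ∀ k, k ≠ i → k ≠ j → w k = v k) :
    ∑ k, TreeVertex.h (w k) = ∑ k, TreeVertex.h (v k) := by
  have key : ∀ k, TreeVertex.h (w k) =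
      TreeVertex.h (v k) + ((if k = i then -c else 0) + (if k = j then c else 0)) := by
    intro k
    rw [h_eq_height, h_eq_height]
    by_cases h1 : k = i
    · subst h1
      rw [hi, if_pos rfl, if_neg hij]
      ring
    · by_cases h2 : k = j
      · subst h2
        rw [hj, if_neg h1, if_pos rfl]
        ring
      · rw [hk k h1 h2, if_neg h1, if_neg h2]
        ring
  simp only [key, Finset.sum_add_distrib, Finset.sum_ite_eq', Finset.mem_univ, if_true]
  ring

/-- One can move down `n` edges in tree `i` while moving up `n` edges to any prescribed vertex in
tree `j`. -/
theorem exists_reachable {i j : Fin d} (hij : i ≠ j) (n : ℕ) (v : DL d q) (u : TreeVertex q)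
    (hu : pred^[n] u = proj j v) :
    ∃ w, (graph d q).Reachable v w ∧ proj i w = pred^[n] (proj i v) ∧ proj j w = u ∧
      ∀ k, k ≠ i → k ≠ j → proj k w = proj k v := by
  induction n generalizing u with
  | zero => exact ⟨v, SimpleGraph.Reachable.refl v, rfl, hu.symm, fun _ _ _ => rfl⟩
  | succ n ih =>
    obtain ⟨w, hw, hwi, hwj, hwk⟩ := ih (pred u) hu
    let f : Fin d → TreeVertex q := fun k =>
      if k = i then pred (proj i w) else if k = j then u else proj k w
    have fi : f i = pred (proj i w) := if_pos rfl
    have fj : f j = u := by simp [f, hij.symm]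
    have fk : ∀ k, k ≠ i → k ≠ j → f k = proj k w := fun k h1 h2 => by simp [f, h1, h2]
    have hsum : ∑ k, TreeVertex.h (f k) = 0 := by
      refine (sum_h_eq (v := w.1) hij 1 ?_ ?_ fk).trans w.2
      · rw [fi]
        rfl
      · rw [fj]
        have : (w.1 j) = pred u := hwj
        rw [this]
        simp [pred]
    have hadj : (graph d q).Adj w ⟨f, hsum⟩ :=
      ⟨i, j, hij, Or.inl fi.symm, Or.inr ((congrArg pred fj).trans hwj.symm),
        fun k h1 h2 => (fk k h1 h2).symm⟩
    refine ⟨⟨f, hsum⟩, hw.trans hadj.reachable, ?_, fj, fun k h1 h2 => ?_⟩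
    · rw [Function.iterate_succ_apply', ← hwi]
      exact fi
    · exact (fk k h1 h2).trans (hwk k h1 h2)

theorem pred_iterate_succ (n : ℕ) (v : TreeVertex q) : pred^[n] ((succ 0)^[n] v) = v :=
  (Function.LeftInverse.iterate (pred_succ 0) n) v

/-- Tree `i` can be moved to its base point, compensating in tree `j`. -/
theorem exists_reachable_base {i j : Fin d} (hij : i ≠ j) (v : DL d q) :
    ∃ w, (graph d q).Reachable v w ∧ proj i w = TreeVertex.base ∧
      ∀ k, k ≠ i → k ≠ j → proj k w = proj k v := by
  obtain ⟨a, b, hab⟩ := exists_common (proj i v) TreeVertex.base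
  obtain ⟨w, hw, hwi, -, hwk⟩ :=
    exists_reachable hij a v ((succ 0)^[a] (proj j v)) (pred_iterate_succ _ _)
  obtain ⟨x, hx, -, hxi, hxk⟩ :=
    exists_reachable hij.symm b w TreeVertex.base (hab.symm.trans hwi.symm)
  exact ⟨x, hw.trans hx, hxi, fun k h1 h2 => (hxk k h2 h1).trans (hwk k h1 h2)⟩

theorem connected : (graph 3 q).Connected := by
  have key : ∀ v : DL 3 q, (graph 3 q).Reachable v base := by
    intro v
    obtain ⟨w, hw, hw0, -⟩ := exists_reachable_base (i := 0) (j := 2) (by decide) v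
    obtain ⟨x, hx, hx1, hxk⟩ := exists_reachable_base (i := 1) (j := 2) (by decide) w
    have hx0 : proj 0 x = TreeVertex.base := (hxk 0 (by decide) (by decide)).trans hw0
    have hx2 : (proj 2 x).height = 0 := by
      have hs := x.2
      rw [Fin.sum_univ_three, h_eq_height, h_eq_height, h_eq_height] at hs
      have e0 : (x.1 0).height = 0 := congrArg height hx0
      have e1 : (x.1 1).height = 0 := congrArg height hx1
      have : (x.1 2).height = 0 := by omega
      exact this
    obtain ⟨a, b, hab⟩ := exists_common (proj 2 x) TreeVertex.base
    have hba : b = a := by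
      have := congrArg height hab
      rw [height_iterate_pred, height_iterate_pred, hx2] at this
      have h0 : (TreeVertex.base : TreeVertex q).height = 0 := rfl
      omega
    subst hba
    obtain ⟨y, hy, hy2, hy0, hyk⟩ := exists_reachable (i := 2) (j := 0) (by decide) b x
      ((succ 0)^[b] (proj 0 x)) (pred_iterate_succ _ _)
    obtain ⟨z, hz, hz0, hz2, hzk⟩ := exists_reachable (i := 0) (j := 2) (by decide) b y
      TreeVertex.base (hab.symm.trans hy2.symm)
    have hzb : z = base := by
      apply ext_proj
      intro k
      fin_cases k
      · exact hz0.trans (by rw [hy0, pred_iterate_succ, hx0]; rfl)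
      · exact (hzk 1 (by decide) (by decide)).trans
          ((hyk 1 (by decide) (by decide)).trans hx1)
      · exact hz2
    exact hzb ▸ (hw.trans (hx.trans (hy.trans hz)))
  have : Nonempty (DL 3 q) := ⟨base⟩
  exact ⟨fun v w => (key v).trans (key w).symm⟩

/-- The vertex set of `DL_3(q)` with the graph metric. -/
noncomputable instance : MetricSpace (DL 3 q) where
  dist v w := ((graph 3 q).dist v w : ℝ)
  dist_self v := by simp
  dist_comm v w := by rw [SimpleGraph.dist_comm]
  dist_triangle u v w := by exact_mod_cast connected.dist_triangle
  eq_of_dist_eq_zero {v w} h0 := connected.dist_eq_zero_iff.1 (by exact_mod_cast h0)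

theorem dist_eq (v w : DL 3 q) : dist v w = ((graph 3 q).dist v w : ℝ) := rfl

/-- The point `α_n`: move up `n` edges labelled `1` in the first tree and down `n` edges in the
second tree. -/
def alphaSeq (q : ℕ) [NeZero q] (n : ℕ) : DL 3 q :=
  ⟨![(succ 1)^[n] TreeVertex.base, pred^[n] TreeVertex.base, TreeVertex.base], by
    simp [Fin.sum_univ_three, h_eq_height, height_iterate_pred, height_iterate_succ,
      TreeVertex.base]⟩

/-- The point `β_n`: in the third tree, move down `n` edges and then up `n` edges labelled `1`. -/
def betaSeq (q : ℕ) [NeZero q] (n : ℕ) : DL 3 q :=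
  ⟨![TreeVertex.base, TreeVertex.base, (succ 1)^[n] (pred^[n] TreeVertex.base)], by
    simp [Fin.sum_univ_three, h_eq_height, height_iterate_pred, height_iterate_succ,
      TreeVertex.base]⟩

/-- `m_i(h) = L`, where `L ∈ {0, 1, 2, …} ∪ {∞}`: for any sequence `(x_n)` of points of `DL_3(q)`
approaching `h`, the sequence `(m_i(x_n))` has limit `L`. -/
def IsLimitM (i : Fin 3) (h : HoroClosure (base : DL 3 q)) (L : ℕ∞) : Prop :=
  ∀ x : ℕ → DL 3 q, Tendsto (fun n => horoEmbed base (x n)) atTop (𝓝 h) →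
    Tendsto (fun n => (mAt i (x n) : ℕ∞)) atTop (𝓝 L)

end DL

/-! Along a path from `v` to `w` each tree has to descend to the greatest common ancestor of its two
coordinates, and every edge descended in one tree is an edge climbed in another. Hence the distance
is the minimum, over the six orders in which the three ancestors can be reached, of the explicit
piecewise linear expression `tourLength` (`dist_le_tourLength`, `exists_tourLength_le_dist`).
Distances are then compared tour by tour. In particular, lowering one common ancestor while all end
heights are kept lengthens every tour (`dist_add_le_dist_of_height_inf`).

This makes `m_i` visible to horofunctions: `branchAt i k` is farther from `x` than the base point
exactly when `m_i(x) < k` (`mAt_lt_iff`). Horofunctions are integer valued, so such signs stabilise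
along a convergent sequence, and the limit function determines the limit of `m_i`. The sequences
`α_n` and `β_n` converge because their distances to any fixed vertex eventually grow by a constant
step.

Near `β` the graph has only points `(o, o, v)` with `m(v)` large (`eventually_nhds_lim_betaSeq`).
For such a point `x`, and any `z` whose third coordinate lies above `o`, the common ancestor in the
third tree drops from `o` by `m(v)`, so `d(z, x) ≥ d(z, o) + m(v)`. Thus `z` leaves every halfspace
of bounded constant. Since `m_3 = 0` is an open condition, this excludes limits of such `z` from the
star of `β`. Conversely, `d(β_n, α_n) ≤ 2n ≤ d(β_n, o)`: on the way to `α_n`, the descent in the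
third tree pays for the climb in the first, and the descent in the second pays for the climb in the
third. So `β_n` lies in the halfspace of `α_n` with `C = 0`. -/

namespace TreeVertex

variable {q : ℕ} [NeZero q]

/-! ### Ancestors and common ancestors in the tree -/

theorem height_pred (v : TreeVertex q) : (pred v).height = v.height - 1 := rfl

theorem height_base : (base : TreeVertex q).height = 0 := rfl

theorem pred_le (v : TreeVertex q) : pred v ≤ v := ⟨1, rfl⟩

theorem height_mono {v w : TreeVertex q} (hvw : v ≤ w) : v.height ≤ w.height := by
  obtain ⟨n, rfl⟩ := hvw
  rw [height_iterate_pred]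
  omega

theorem iterate_pred_eq_of_le {v w : TreeVertex q} (hwv : w ≤ v) {n : ℕ}
    (hn : (n : ℤ) = v.height - w.height) : pred^[n] v = w := by
  obtain ⟨k, rfl⟩ := hwv
  rw [height_iterate_pred] at hn
  obtain rfl : n = k := by omega
  rfl

theorem eq_of_le_of_height_le {v w : TreeVertex q} (hvw : v ≤ w) (hh : w.height ≤ v.height) :
    v = w :=
  (iterate_pred_eq_of_le (n := 0) hvw (by have := height_mono hvw; push_cast; omega)).symm

/-- The ancestors of a vertex form a chain. -/
theorem le_of_height_le {u v w : TreeVertex q} (hu : u ≤ w) (hv : v ≤ w)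
    (hh : u.height ≤ v.height) : u ≤ v := by
  obtain ⟨n, rfl⟩ := hu
  obtain ⟨k, rfl⟩ := hv
  rw [height_iterate_pred, height_iterate_pred] at hh
  exact ⟨n - k, by rw [← Function.iterate_add_apply, Nat.sub_add_cancel (by omega)]⟩

theorem le_pred_of_lt {v w : TreeVertex q} (hvw : v < w) : v ≤ pred w :=
  le_of_height_le hvw.le (pred_le w) <| by
    have h1 : ¬ w.height ≤ v.height := fun hh => hvw.ne (eq_of_le_of_height_le hvw.le hh)
    rw [height_pred]
    omega

theorem height_inf_le_left (v w : TreeVertex q) : (v ⊓ w).height ≤ v.height :=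
  height_mono inf_le_left

theorem height_inf_le_right (v w : TreeVertex q) : (v ⊓ w).height ≤ w.height :=
  height_mono inf_le_right

/-- The ultrametric inequality for common ancestors. -/
theorem height_inf_of_le (u v w : TreeVertex q) (hh : (u ⊓ v).height ≤ (v ⊓ w).height) :
    (u ⊓ v).height ≤ (u ⊓ w).height :=
  height_mono <| le_inf inf_le_left <|
    (le_of_height_le inf_le_right inf_le_left hh).trans inf_le_right

theorem height_inf_of_lt (u v w : TreeVertex q) (hh : (u ⊓ v).height < (v ⊓ w).height) :
    (u ⊓ w).height = (u ⊓ v).height := by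
  refine le_antisymm ?_ (height_inf_of_le u v w hh.le)
  by_contra! hlt
  rcases le_total (u ⊓ w).height (v ⊓ w).height with h1 | h1
  · have h2 := height_inf_of_le u w v (by rwa [inf_comm w v])
    omega
  · have h2 := height_inf_of_le v w u (by rwa [inf_comm w u])
    rw [inf_comm v u] at h2
    omega

theorem natCast_m (v : TreeVertex q) : (m v : ℤ) = -(base ⊓ v).height := by
  rw [m, dist_of_le inf_le_left, height_base]
  ring

theorem height_inf_succ_le (v w : TreeVertex q) (a : Fin q) :
    (succ a v ⊓ w).height ≤ (v ⊓ w).height ∨ succ a v ≤ w := by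
  by_cases hw : succ a v ≤ w
  · exact Or.inr hw
  · refine Or.inl (height_mono (le_inf ?_ inf_le_right))
    have h1 : succ a v ⊓ w < succ a v :=
      lt_of_le_of_ne inf_le_left fun he => hw (inf_eq_left.1 he)
    simpa only [pred_succ] using le_pred_of_lt h1

theorem label_of_le {v w : TreeVertex q} (hvw : v ≤ w) {k : ℤ} (hk : k < v.height) :
    v.label k = w.label k := by
  obtain ⟨n, rfl⟩ := hvw
  rw [height_iterate_pred] at hk
  rw [label_iterate_pred, if_pos hk]

theorem label_iterate_succ (a : Fin q) (n : ℕ) (v : TreeVertex q) {k : ℤ} (hk : v.height ≤ k)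
    (hk' : k < v.height + n) : ((succ a)^[n] v).label k = a := by
  induction n with
  | zero => push_cast at hk'; omega
  | succ n ih =>
    rw [Function.iterate_succ_apply']
    push_cast at hk'
    have hh := height_iterate_succ a n v
    by_cases h1 : k = ((succ a)^[n] v).height
    · exact if_pos h1
    · exact (if_neg h1).trans (ih (by omega))

theorem succ_injective_label {a b : Fin q} {v : TreeVertex q} (hab : succ a v = succ b v) :
    a = b := by
  have := congrArg (fun u => u.label v.height) hab
  simpa [succ] using this

theorem le_iterate_succ (a : Fin q) (n : ℕ) (v : TreeVertex q) : v ≤ (succ a)^[n] v :=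
  ⟨n, (Function.LeftInverse.iterate (pred_succ a) n) v⟩

theorem iterate_pred_iterate_succ (a : Fin q) (n k : ℕ) (v : TreeVertex q) :
    pred^[n] ((succ a)^[n + k] v) = (succ a)^[k] v := by
  rw [Function.iterate_add_apply]
  exact (Function.LeftInverse.iterate (pred_succ a) n) _

theorem eq_base_of_le {v : TreeVertex q} (hv : base ≤ v) (hh : v.height ≤ 0) : v = base :=
  (eq_of_le_of_height_le hv hh).symm

theorem base_le_of_m_eq_zero {v : TreeVertex q} (hv : m v = 0) : base ≤ v := by
  have h1 := natCast_m v
  rw [hv] at h1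
  have h2 : base ⊓ v = base :=
    eq_of_le_of_height_le inf_le_left (by rw [height_base]; push_cast at h1; omega)
  exact inf_eq_left.1 h2

/-- The vertex reached from `base` by `k` edges down and `k` edges labelled `1` up. -/
def branch (q : ℕ) [NeZero q] (k : ℕ) : TreeVertex q := (succ 1)^[k] (pred^[k] base)

theorem height_branch (k : ℕ) : (branch q k).height = 0 := by
  rw [branch, height_iterate_succ, height_iterate_pred, height_base]
  ring

/-- A common ancestor above height `-k` would determine the label of the edge at height `-k`, which
is `0` below `base` and `1` below the branch; these differ since `2 ≤ q`. -/
theorem height_base_inf_branch (hq : 2 ≤ q) (k : ℕ) : (base ⊓ branch q k).height = -k := by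
  have hle : pred^[k] (base : TreeVertex q) ≤ base ⊓ branch q k :=
    le_inf ⟨k, rfl⟩ (le_iterate_succ _ _ _)
  have h1 := height_mono hle
  rw [height_iterate_pred, height_base] at h1
  by_contra hne
  have hlt : (-k : ℤ) < (base ⊓ branch q k).height := by omega
  have h3 := height_inf_le_left base (branch q k)
  rw [height_base] at h3
  have e1 := label_of_le (inf_le_left : base ⊓ branch q k ≤ base) hlt
  have e2 := label_of_le (inf_le_right : base ⊓ branch q k ≤ branch q k) hlt
  rw [branch, label_iterate_succ 1 k _ (by rw [height_iterate_pred, height_base]; omega)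
    (by rw [height_iterate_pred, height_base]; omega), ← branch, e1] at e2
  have h4 : (0 : Fin q).val = (1 : Fin q).val := congrArg Fin.val e2
  rw [Fin.val_zero, Fin.val_one', Nat.mod_eq_of_lt hq] at h4
  omega

theorem height_base_inf_iterate_pred (n : ℕ) (v : TreeVertex q)
    (hn : -(n : ℤ) ≤ (base ⊓ v).height) : (v ⊓ pred^[n] base).height = -n := by
  have h1 : pred^[n] (base : TreeVertex q) ≤ base ⊓ v :=
    le_of_height_le ⟨n, rfl⟩ inf_le_left (by rw [height_iterate_pred, height_base]; omega)
  rw [inf_eq_right.2 (h1.trans inf_le_right), height_iterate_pred, height_base]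
  ring

theorem inf_iterate_succ_succ (a : Fin q) (n : ℕ) (v w : TreeVertex q)
    (hn : v.height ≤ w.height + n) : v ⊓ (succ a)^[n + 1] w = v ⊓ (succ a)^[n] w := by
  have hle : (succ a)^[n] w ≤ (succ a)^[n + 1] w := by
    rw [Function.iterate_succ_apply']
    exact le_iterate_succ a 1 _
  refine le_antisymm (le_inf inf_le_left (le_of_height_le inf_le_right hle ?_))
    (inf_le_inf_left v hle)
  have := height_inf_le_left v ((succ a)^[n + 1] w)
  rw [height_iterate_succ]
  omega

/-- With discreteness of the graph metric, countability makes the compact-open topology first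
countable, so that closure points are limits of sequences in `exists_seq_tendsto`. -/
instance : Countable (TreeVertex q) := by
  let f : TreeVertex q → ℤ × (ℤ →₀ Fin q) := fun v =>
    (v.height, Finsupp.onFinset (Finset.Ico v.label_below.choose v.height) v.label fun k hk => by
      rw [Finset.mem_Ico]
      exact ⟨not_lt.1 fun hlt => hk (v.label_below.choose_spec k hlt),
        not_le.1 fun hle => hk (v.label_above k hle)⟩)
  have hf : Function.Injective f := fun v w hvw => by
    refine TreeVertex.ext (congrArg Prod.fst hvw) ?_
    exact congrArg (fun p : ℤ × (ℤ →₀ Fin q) => (p.2 : ℤ → Fin q)) hvw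
  exact hf.countable

end TreeVertex

namespace DL

open TreeVertex

variable {q : ℕ} [NeZero q]

/-! ### The distance in `DL_3(q)` -/

theorem sum_height {a b c : Fin 3} (hab : a ≠ b) (hac : a ≠ c) (hbc : b ≠ c) (v : DL 3 q) :
    (proj a v).height + (proj b v).height + (proj c v).height = 0 := by
  have huniv : ∀ a b c : Fin 3, a ≠ b → a ≠ c → b ≠ c → Finset.univ = {a, b, c} := by decide
  obtain ⟨f, hs⟩ := v
  rw [huniv a b c hab hac hbc, Finset.sum_insert (by simp [hab, hac]),
    Finset.sum_insert (by simp [hbc]), Finset.sum_singleton, h_eq_height, h_eq_height,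
    h_eq_height] at hs
  rw [add_assoc]
  exact hs

theorem eq_or_eq_or_eq {a b c : Fin 3} (hab : a ≠ b) (hac : a ≠ c) (hbc : b ≠ c) (i : Fin 3) :
    i = a ∨ i = b ∨ i = c := by
  revert a b c i
  decide

/-- Moving tree `i` down and tree `j` up to a prescribed vertex, by `n` edges. -/
theorem exists_dist_le {i j : Fin 3} (hij : i ≠ j) (n : ℕ) (v : DL 3 q) (u : TreeVertex q)
    (hu : pred^[n] u = proj j v) :
    ∃ w, (graph 3 q).dist v w ≤ n ∧ proj i w = pred^[n] (proj i v) ∧ proj j w = u ∧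
      ∀ k, k ≠ i → k ≠ j → proj k w = proj k v := by
  induction n generalizing u with
  | zero => exact ⟨v, by simp, rfl, hu.symm, fun _ _ _ => rfl⟩
  | succ n ih =>
    obtain ⟨w, hw, hwi, hwj, hwk⟩ := ih (pred u) hu
    let f : Fin 3 → TreeVertex q := fun k =>
      if k = i then pred (proj i w) else if k = j then u else proj k w
    have fi : f i = pred (proj i w) := if_pos rfl
    have fj : f j = u := by simp [f, hij.symm]
    have fk : ∀ k, k ≠ i → k ≠ j → f k = proj k w := fun k h1 h2 => by simp [f, h1, h2]
    have hsum : ∑ k, TreeVertex.h (f k) = 0 := by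
      refine (sum_h_eq (v := w.1) hij 1 ?_ ?_ fk).trans w.2
      · rw [fi]
        rfl
      · rw [fj, show w.1 j = pred u from hwj, height_pred]
        ring
    have hadj : (graph 3 q).Adj w ⟨f, hsum⟩ :=
      ⟨i, j, hij, Or.inl fi.symm, Or.inr ((congrArg pred fj).trans hwj.symm),
        fun k h1 h2 => (fk k h1 h2).symm⟩
    refine ⟨⟨f, hsum⟩, ?_, ?_, fj, fun k h1 h2 => (fk k h1 h2).trans (hwk k h1 h2)⟩
    · have h1 := connected.dist_triangle (u := v) (v := w) (w := ⟨f, hsum⟩)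
      have h2 := SimpleGraph.dist_eq_one_iff_adj.2 hadj
      omega
    · rw [Function.iterate_succ_apply', ← hwi]
      exact fi

/-- The length of a shortest tour through the trees `a`, `b`, `c` in this order, that descends `m i`
edges to a common ancestor and ascends `l i` edges from it in the tree `i`. -/
def tourLength (m l : Fin 3 → ℤ) (a b c : Fin 3) : ℤ :=
  m a + l c + max (m a + m b + m c) (m b + l b)

/-- The final climb of `l c` edges in tree `c` has to be paid by a descent. Tree `a`, already done
with its own descent, pays for it: it first overshoots its end point by `l c` edges, along edges
labelled `0`, and comes back at the end. -/
theorem dist_le_of_iterate_pred {a b c : Fin 3} (hab : a ≠ b) (hac : a ≠ c) (hbc : b ≠ c)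
    (v w : DL 3 q) (m l : Fin 3 → ℕ) (hml : ∀ i, pred^[m i] (proj i v) = pred^[l i] (proj i w)) :
    (graph 3 q).dist v w ≤ m a + l c + max (m a + m b + m c) (m b + l b) := by
  have hsum : m a + m b + m c = l a + l b + l c := by
    have h1 := sum_height hab hac hbc v
    have h2 := sum_height hab hac hbc w
    have e := fun i => congrArg height (hml i)
    simp only [height_iterate_pred] at e
    have ea := e a
    have eb := e b
    have ec := e c
    omega
  obtain ⟨x₁, d₁, a₁, c₁, k₁⟩ := exists_dist_le hac (m a) v ((succ 0)^[m a] (proj c v))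
    (pred_iterate_succ _ _)
  have b₁ := k₁ b hab.symm hbc
  let W := (succ 0)^[l c + m b] (proj a w)
  have hWA : pred^[m b] W = (succ 0)^[l c] (proj a w) := by
    rw [show W = (succ 0)^[m b + l c] (proj a w) by rw [add_comm (m b)]]
    exact iterate_pred_iterate_succ 0 (m b) (l c) _
  obtain ⟨x₂, d₂, b₂, a₂, k₂⟩ := exists_dist_le hab.symm (m b) x₁ (pred^[l a + l c] W) <| by
    rw [← Function.iterate_add_apply, add_comm, Function.iterate_add_apply, hWA,
      Function.iterate_add_apply, pred_iterate_succ, a₁, hml]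
  have c₂ := k₂ c hbc.symm hac.symm
  have hfin : ∀ (x : DL 3 q), proj a x = (succ 0)^[l c] (proj a w) → proj b x = proj b w →
      proj c x = pred^[l c] (proj c w) → (graph 3 q).dist x w ≤ l c := by
    intro x xa xb xc
    obtain ⟨y, dy, ya, yc, yk⟩ := exists_dist_le hac (l c) x (proj c w) xc.symm
    have hy : y = w := by
      apply ext_proj
      intro i
      rcases eq_or_eq_or_eq hab hac hbc i with rfl | rfl | rfl
      · rw [ya, xa, pred_iterate_succ]
      · rw [yk _ hab.symm hbc, xb]
      · exact yc
    rwa [← hy]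
  have tri := fun x y z : DL 3 q => connected.dist_triangle (u := x) (v := y) (w := z)
  have t₁ := tri v x₁ w
  have t₂ := tri x₁ x₂ w
  -- If tree `a` has not yet climbed to `l c` above its end, tree `c` descends for the missing `k`
  -- edges, and the middle part has length `l a + l b + l c = m a + m b + m c`. Otherwise tree `a`
  -- is `k` edges too high, and its descent pays for the rest of the climb in tree `b`; the middle
  -- part has length `m b + l b`.
  rcases le_total (m b) (l a + l c) with hle | hle
  · obtain ⟨k, hk⟩ := Nat.exists_eq_add_of_le hle
    obtain ⟨x₃, d₃, c₃, b₃, k₃⟩ := exists_dist_le hbc.symm (l b) x₂ (proj b w)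
      (by rw [b₂, b₁, hml])
    have a₃ := k₃ a hac hab
    obtain ⟨x₄, d₄, c₄, a₄, k₄⟩ := exists_dist_le hac.symm k x₃ ((succ 0)^[l c] (proj a w)) <| by
      rw [a₃, a₂, hk, add_comm, Function.iterate_add_apply, hWA]
    have b₄ := k₄ b hbc hab.symm
    have hx := hfin x₄ a₄ (b₄.trans b₃) <| by
      rw [c₄, c₃, c₂, c₁, ← Function.iterate_add_apply, ← hml,
        show k + l b = m c + m a by omega, Function.iterate_add_apply, pred_iterate_succ]
    have t₃ := tri x₂ x₃ w
    have t₄ := tri x₃ x₄ w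
    have := le_max_left (m a + m b + m c) (m b + l b)
    omega
  · obtain ⟨k, hk⟩ := Nat.exists_eq_add_of_le hle
    obtain ⟨x₃, d₃, c₃, b₃, k₃⟩ := exists_dist_le hbc.symm (m c + m a) x₂ (pred^[k] (proj b w)) <| by
      rw [b₂, b₁, ← Function.iterate_add_apply, hml, show m c + m a + k = l b by omega]
    have a₃ := k₃ a hac hab
    obtain ⟨x₄, d₄, a₄, b₄, k₄⟩ := exists_dist_le hab k x₃ (proj b w) b₃.symm
    have c₄ := k₄ c hac.symm hbc.symm
    have hx := hfin x₄ (by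
      rw [a₄, a₃, a₂, ← Function.iterate_add_apply, add_comm k, ← hk, hWA]) b₄ <| by
      rw [c₄, c₃, c₂, c₁, Function.iterate_add_apply, pred_iterate_succ, hml]
    have t₃ := tri x₂ x₃ w
    have t₄ := tri x₃ x₄ w
    have := le_max_right (m a + m b + m c) (m b + l b)
    omega

/-- The `t i` may be any common ancestors, so explicit tours can be bounded without computing
greatest ones. -/
theorem dist_le_tourLength {a b c : Fin 3} (hab : a ≠ b) (hac : a ≠ c) (hbc : b ≠ c)
    (v w : DL 3 q) (t : Fin 3 → TreeVertex q) (htv : ∀ i, t i ≤ proj i v)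
    (htw : ∀ i, t i ≤ proj i w) :
    ((graph 3 q).dist v w : ℤ) ≤ tourLength (fun i => (proj i v).height - (t i).height)
      (fun i => (proj i w).height - (t i).height) a b c := by
  have hm : ∀ i, (((proj i v).height - (t i).height).toNat : ℤ) =
      (proj i v).height - (t i).height := fun i =>
    Int.toNat_of_nonneg (sub_nonneg.2 (height_mono (htv i)))
  have hl : ∀ i, (((proj i w).height - (t i).height).toNat : ℤ) =
      (proj i w).height - (t i).height := fun i =>
    Int.toNat_of_nonneg (sub_nonneg.2 (height_mono (htw i)))
  have key := dist_le_of_iterate_pred hab hac hbc v w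
    (fun i => ((proj i v).height - (t i).height).toNat)
    (fun i => ((proj i w).height - (t i).height).toNat) fun i =>
      (iterate_pred_eq_of_le (htv i) (hm i)).trans (iterate_pred_eq_of_le (htw i) (hl i)).symm
  have key' : ((graph 3 q).dist v w : ℤ) ≤ _ := Int.ofNat_le.2 key
  push_cast [hm, hl] at key'
  exact_mod_cast key'

theorem height_adj_le {v w : DL 3 q} (hvw : (graph 3 q).Adj v w) (i : Fin 3) :
    |(proj i v).height - (proj i w).height| ≤ 1 := by
  obtain ⟨a, b, -, h1, h2, h3⟩ := hvw
  have key : ∀ x y : TreeVertex q, (TreeVertex.graph q).Adj x y → |x.height - y.height| ≤ 1 := by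
    rintro x y (rfl | rfl) <;> simp [pred]
  by_cases ha : i = a
  · exact ha ▸ key _ _ h1
  · by_cases hb : i = b
    · exact hb ▸ key _ _ h2
    · simp [h3 i ha hb]

theorem abs_height_getVert_sub_le {v w : DL 3 q} (p : (graph 3 q).Walk v w) (i : Fin 3) (s n : ℕ) :
    |(proj i (p.getVert s)).height - (proj i (p.getVert (s + n))).height| ≤ n := by
  induction n with
  | zero => simp
  | succ n ih =>
    have h1 : |(proj i (p.getVert (s + n))).height - (proj i (p.getVert (s + n + 1))).height| ≤
        1 := by
      rcases lt_or_ge (s + n) p.length with hlt | hge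
      · exact height_adj_le (p.adj_getVert_succ hlt) i
      · rw [p.getVert_of_length_le hge, p.getVert_of_length_le (by omega)]
        simp
    have h2 := abs_sub_le (proj i (p.getVert s)).height (proj i (p.getVert (s + n))).height
      (proj i (p.getVert (s + (n + 1)))).height
    push_cast
    rw [← add_assoc] at h2 ⊢
    linarith

/-- A walk descends in each tree to the greatest common ancestor of its end points. -/
theorem exists_height_getVert_le {v w : DL 3 q} (p : (graph 3 q).Walk v w) (i : Fin 3) :
    ∃ s ≤ p.length, (proj i (p.getVert s)).height ≤ (proj i v ⊓ proj i w).height := by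
  induction p with
  | nil => exact ⟨0, le_rfl, by simp⟩
  | @cons v u w hvu p ih =>
    by_cases hv : proj i v ≤ proj i w
    · exact ⟨0, Nat.zero_le _, by rw [SimpleGraph.Walk.getVert_zero, inf_eq_left.2 hv]⟩
    · obtain ⟨s, hs, hle⟩ := ih
      refine ⟨s + 1, by simpa using hs, ?_⟩
      rw [SimpleGraph.Walk.getVert_cons_succ]
      refine hle.trans (height_mono (le_inf ?_ inf_le_right))
      -- Stepping from a vertex that is not an ancestor of the target cannot produce a higher common
      -- ancestor with the target.
      have key : ∀ x y z : TreeVertex q, (TreeVertex.graph q).Adj x y → ¬ x ≤ z → y ⊓ z ≤ x := by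
        rintro x y z (rfl | rfl) hx
        · exact inf_le_left.trans (pred_le x)
        · refine le_pred_of_lt (lt_of_le_of_ne inf_le_left fun he => hx ?_)
          exact (pred_le y).trans (inf_eq_left.1 he)
      obtain ⟨a, b, -, h1, h2, h3⟩ := hvu
      by_cases ha : i = a
      · exact ha ▸ key _ _ _ h1 (ha ▸ hv)
      · by_cases hb : i = b
        · exact hb ▸ key _ _ _ h2 (hb ▸ hv)
        · rw [h3 i ha hb]
          exact inf_le_left

/-- Clearly `r ≥ m a`, and at least `l c` steps follow time `t`. At time `s` the heights are at most
`g a + (s - r)`, `g b` and `g c + (t - s)`; they sum to zero, so `t - r ≥ -(g a + g b + g c)`, which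
is the sum of the `m i`. The other term of the maximum comes from `s ≥ m a + m b` and its mirror
image `p.length - s ≥ l b + l c`, again by the zero sum. -/
theorem tourLength_le_length {v w : DL 3 q} (p : (graph 3 q).Walk v w) (g : Fin 3 → ℤ)
    {a b c : Fin 3} (hab : a ≠ b) (hac : a ≠ c) (hbc : b ≠ c) {r s t : ℕ} (hrs : r ≤ s)
    (hst : s ≤ t) (ht : t ≤ p.length) (hr : (proj a (p.getVert r)).height ≤ g a)
    (hs : (proj b (p.getVert s)).height ≤ g b) (ht' : (proj c (p.getVert t)).height ≤ g c) :
    tourLength (fun i => (proj i v).height - g i) (fun i => (proj i w).height - g i) a b c ≤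
      p.length := by
  have h1 := fun i => abs_le.1 (abs_height_getVert_sub_le p i 0 r)
  have h2 := fun i => abs_le.1 (abs_height_getVert_sub_le p i r (s - r))
  have h3 := fun i => abs_le.1 (abs_height_getVert_sub_le p i s (t - s))
  have h4 := fun i => abs_le.1 (abs_height_getVert_sub_le p i t (p.length - t))
  simp only [Nat.zero_add, Nat.add_sub_of_le hrs, Nat.add_sub_of_le hst, Nat.add_sub_of_le ht,
    SimpleGraph.Walk.getVert_zero, SimpleGraph.Walk.getVert_length] at h1 h2 h3 h4
  have sv := sum_height hab hac hbc v
  have sw := sum_height hab hac hbc w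
  have s1 := sum_height hab hac hbc (p.getVert r)
  have s2 := sum_height hab hac hbc (p.getVert s)
  have s3 := sum_height hab hac hbc (p.getVert t)
  have a1 := h1 a
  have c1 := h1 c
  have a2 := h2 a
  have b2 := h2 b
  have b3 := h3 b
  have c3 := h3 c
  have a4 := h4 a
  have c4 := h4 c
  dsimp only [tourLength]
  rw [← le_sub_iff_add_le']
  apply max_le <;> omega

theorem exists_tourLength_le_dist (v w : DL 3 q) :
    ∃ a b c : Fin 3, a ≠ b ∧ a ≠ c ∧ b ≠ c ∧
      tourLength (fun i => (proj i v).height - (proj i v ⊓ proj i w).height)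
        (fun i => (proj i w).height - (proj i v ⊓ proj i w).height) a b c ≤
      (graph 3 q).dist v w := by
  obtain ⟨p, hp⟩ := connected.exists_walk_length_eq_dist v w
  choose s hs hle using exists_height_getVert_le p
  obtain ⟨a, b, c, hab, hac, hbc, h1, h2⟩ :
      ∃ a b c : Fin 3, a ≠ b ∧ a ≠ c ∧ b ≠ c ∧ s a ≤ s b ∧ s b ≤ s c := by
    rcases le_total (s 0) (s 1) with h01 | h01 <;> rcases le_total (s 0) (s 2) with h02 | h02 <;>
      rcases le_total (s 1) (s 2) with h12 | h12
    · exact ⟨0, 1, 2, by decide, by decide, by decide, h01, h12⟩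
    · exact ⟨0, 2, 1, by decide, by decide, by decide, h02, h12⟩
    · exact ⟨0, 1, 2, by decide, by decide, by decide, h01, h12⟩
    · exact ⟨2, 0, 1, by decide, by decide, by decide, h02, h01⟩
    · exact ⟨1, 0, 2, by decide, by decide, by decide, h01, h02⟩
    · exact ⟨1, 0, 2, by decide, by decide, by decide, h01, h02⟩
    · exact ⟨1, 2, 0, by decide, by decide, by decide, h12, h02⟩
    · exact ⟨2, 1, 0, by decide, by decide, by decide, h12, h01⟩
  refine ⟨a, b, c, hab, hac, hbc, ?_⟩
  rw [← hp]
  exact tourLength_le_length p (fun i => (proj i v ⊓ proj i w).height) hab hac hbc h1 h2 (hs c)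
    (hle a) (hle b) (hle c)

/-- Distances can be compared tour by tour. -/
theorem dist_add_le_dist {v w v' w' : DL 3 q} {g g' : Fin 3 → ℤ} {K : ℤ}
    (hg : ∀ i, (proj i v ⊓ proj i w).height = g i)
    (hg' : ∀ i, (proj i v' ⊓ proj i w').height = g' i)
    (hK : ∀ a b c : Fin 3, a ≠ b → a ≠ c → b ≠ c →
      tourLength (fun i => (proj i v).height - g i) (fun i => (proj i w).height - g i) a b c + K ≤
      tourLength (fun i => (proj i v').height - g' i) (fun i => (proj i w').height - g' i) a b c) :
    ((graph 3 q).dist v w : ℤ) + K ≤ (graph 3 q).dist v' w' := by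
  obtain ⟨a, b, c, hab, hac, hbc, hle⟩ := exists_tourLength_le_dist v' w'
  have h1 := dist_le_tourLength hab hac hbc v w (fun i => proj i v ⊓ proj i w)
    (fun i => inf_le_left) (fun i => inf_le_right)
  simp only [hg] at h1
  simp only [hg'] at hle
  have h2 := hK a b c hab hac hbc
  omega

/-- Lowering a greatest common ancestor by `K`, while the heights of the end points are kept,
increases the distance by at least `K`. -/
theorem dist_add_le_dist_of_height_inf {v w v' w' : DL 3 q} {K : ℤ} (j : Fin 3)
    (hv : ∀ i, (proj i v').height = (proj i v).height)
    (hw : ∀ i, (proj i w').height = (proj i w).height)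
    (hi : ∀ i, (proj i v' ⊓ proj i w').height ≤ (proj i v ⊓ proj i w).height)
    (hj : (proj j v' ⊓ proj j w').height + K ≤ (proj j v ⊓ proj j w).height) :
    ((graph 3 q).dist v w : ℤ) + K ≤ (graph 3 q).dist v' w' := by
  refine dist_add_le_dist (fun i => rfl) (fun i => rfl) fun a b c hab hac hbc => ?_
  simp only [tourLength, hv, hw]
  have ha := hi a
  have hb := hi b
  have hc := hi c
  rcases eq_or_eq_or_eq hab hac hbc j with rfl | rfl | rfl <;> omega

/-! ### Horofunctions and the functions `m_i` -/

instance : Countable (DL 3 q) :=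
  inferInstanceAs (Countable {v : Fin 3 → TreeVertex q // ∑ i, TreeVertex.h (v i) = 0})

instance : DiscreteTopology (DL 3 q) :=
  DiscreteTopology.of_forall_le_dist one_pos fun v w hvw => by
    change (1 : ℝ) ≤ ((graph 3 q).dist v w : ℝ)
    exact_mod_cast connected.pos_dist_of_ne hvw

theorem proj_base (i : Fin 3) : proj i (base : DL 3 q) = TreeVertex.base := rfl

theorem horoFun_apply (x z : DL 3 q) :
    horoFun base x z = ((graph 3 q).dist z x : ℝ) - (graph 3 q).dist base x := by
  rw [SimpleGraph.dist_comm, SimpleGraph.dist_comm (u := base)]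
  rfl

theorem horoFun_pos_iff {x z : DL 3 q} :
    0 < horoFun base x z ↔ (graph 3 q).dist base x < (graph 3 q).dist z x := by
  rw [horoFun_apply, sub_pos, Nat.cast_lt]

theorem horoFun_neg_iff {x z : DL 3 q} :
    horoFun base x z < 0 ↔ (graph 3 q).dist z x < (graph 3 q).dist base x := by
  rw [horoFun_apply, sub_neg, Nat.cast_lt]

theorem horoFun_lt_one_iff {x z : DL 3 q} :
    horoFun base x z < 1 ↔ ¬ 0 < horoFun base x z := by
  rw [horoFun_pos_iff, horoFun_apply, sub_lt_iff_lt_add, not_lt, ← Nat.lt_succ_iff]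
  exact_mod_cast by rw [add_comm]

theorem horoFun_le_neg_one {x z : DL 3 q} (hx : horoFun base x z < 0) :
    horoFun base x z ≤ -1 := by
  rw [horoFun_neg_iff] at hx
  rw [horoFun_apply]
  have : ((graph 3 q).dist z x : ℝ) + 1 ≤ (graph 3 q).dist base x := by exact_mod_cast hx
  linarith

theorem continuous_eval (z : DL 3 q) :
    Continuous fun ξ : HoroClosure (base : DL 3 q) => ξ.1 z :=
  (continuous_eval_const z).comp continuous_subtype_val

theorem tendsto_horoFun {x : ℕ → DL 3 q} {ξ : HoroClosure (base : DL 3 q)}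
    (hx : Tendsto (fun n => horoEmbed base (x n)) atTop (𝓝 ξ)) (z : DL 3 q) :
    Tendsto (fun n => horoFun base (x n) z) atTop (𝓝 (ξ.1 z)) :=
  ((continuous_eval z).tendsto ξ).comp hx

/-- By integrality, `0 < f` means `1 ≤ f` for the functions of vertices, so positivity is both an
open and a closed condition. -/
theorem eventually_horoFun_pos_iff {x : ℕ → DL 3 q} {ξ : HoroClosure (base : DL 3 q)}
    (hx : Tendsto (fun n => horoEmbed base (x n)) atTop (𝓝 ξ)) (z : DL 3 q) :
    ∀ᶠ n in atTop, (0 < horoFun base (x n) z ↔ 0 < ξ.1 z) := by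
  have ht := tendsto_horoFun hx z
  by_cases h0 : 0 < ξ.1 z
  · filter_upwards [ht.eventually_const_lt h0] with n hn
    exact iff_of_true hn h0
  · filter_upwards [ht.eventually_lt_const ((not_lt.1 h0).trans_lt one_pos)] with n hn
    exact iff_of_false (horoFun_lt_one_iff.1 hn) h0

theorem exists_seq_tendsto (ξ : HoroClosure (base : DL 3 q)) :
    ∃ x : ℕ → DL 3 q, Tendsto (fun n => horoEmbed base (x n)) atTop (𝓝 ξ) := by
  obtain ⟨f, hf, hlim⟩ := mem_closure_iff_seq_limit.1 ξ.2
  choose x hx using hf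
  refine ⟨x, tendsto_subtype_rng.2 ?_⟩
  simpa only [horoEmbed, hx] using hlim

/-- The point whose `i`-th coordinate is `k` edges down and then `k` edges labelled `1` up from the
base point, the other coordinates being the base point. -/
def branchAt (i : Fin 3) (k : ℕ) : DL 3 q :=
  ⟨Function.update (fun _ => TreeVertex.base) i (branch q k), by
    have key : ∀ j, TreeVertex.h (Function.update (fun _ => TreeVertex.base) i (branch q k) j) =
        0 := fun j => by
      rw [h_eq_height]
      by_cases hj : j = i
      · rw [hj, Function.update_self, height_branch]
      · rw [Function.update_of_ne hj, height_base]
    simp only [key, Finset.sum_const_zero]⟩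

theorem proj_branchAt_self (i : Fin 3) (k : ℕ) :
    proj i (branchAt i k : DL 3 q) = branch q k :=
by
  unfold proj branchAt
  exact Function.update_self i (branch q k) fun _ => TreeVertex.base

theorem proj_branchAt_of_ne {i j : Fin 3} (hji : j ≠ i) (k : ℕ) :
    proj j (branchAt i k : DL 3 q) = TreeVertex.base :=
by
  unfold proj branchAt
  exact Function.update_of_ne hji (branch q k) fun _ => TreeVertex.base

theorem height_proj_branchAt (i j : Fin 3) (k : ℕ) :
    (proj j (branchAt i k : DL 3 q)).height = 0 := by
  by_cases hj : j = i
  · rw [hj, proj_branchAt_self, height_branch]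
  · rw [proj_branchAt_of_ne hj, height_base]

/-- Replacing the base point by `branchAt i k` keeps all heights. If `m_i(x) < k`, the common
ancestor with `x` in tree `i` drops from height `-m_i(x)` to `-k`; otherwise it does not drop. -/
theorem mAt_lt_iff (hq : 2 ≤ q) (i : Fin 3) (k : ℕ) (x : DL 3 q) :
    mAt i x < k ↔ 0 < horoFun base x (branchAt i k) := by
  rw [horoFun_pos_iff]
  have hm : (mAt i x : ℤ) = -(TreeVertex.base ⊓ proj i x).height := natCast_m _
  have hb := height_base_inf_branch (q := q) hq k
  rw [inf_comm] at hb
  constructor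
  · intro hlt
    have hi : (proj i (branchAt i k) ⊓ proj i x).height = -k := by
      rw [proj_branchAt_self, ← hb]
      exact height_inf_of_lt _ _ _ (by omega)
    have := dist_add_le_dist_of_height_inf (v := base) (w := x) (v' := branchAt i k) (w' := x)
      (K := k - mAt i x) i (fun j => height_proj_branchAt i j k) (fun _ => rfl) (fun j => by
        by_cases hj : j = i
        · subst hj
          rw [hi, proj_base]
          omega
        · rw [proj_branchAt_of_ne hj, proj_base])
      (by rw [hi, proj_base]; omega)
    omega
  · intro hlt
    by_contra! hge
    have hi : (TreeVertex.base ⊓ proj i x).height ≤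
        (proj i (branchAt i k) ⊓ proj i x).height := by
      rw [proj_branchAt_self, inf_comm, inf_comm (branch q k)]
      refine height_inf_of_le _ _ _ ?_
      rw [inf_comm TreeVertex.base, inf_comm (proj i x)]
      omega
    have := dist_add_le_dist_of_height_inf (v := branchAt i k) (w := x) (v' := base) (w' := x)
      (K := 0) i (fun j => (height_proj_branchAt i j k).symm) (fun _ => rfl) (fun j => by
        by_cases hj : j = i
        · subst hj
          exact hi
        · rw [proj_branchAt_of_ne hj, proj_base])
      (by rw [add_zero]; exact hi)
    omega

/-- For each `k`, whether `m_i(x_n) < k` holds for large `n` is decided by the sign of `ξ` at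
`branchAt i k`. The limit is the supremum of the `k` for which it fails. -/
theorem exists_isLimitM (hq : 2 ≤ q) (i : Fin 3) (ξ : HoroClosure (base : DL 3 q)) :
    ∃ L, IsLimitM i ξ L := by
  refine ⟨⨆ (k : ℕ) (_ : ¬ 0 < ξ.1 (branchAt i k)), (k : ℕ∞), fun x hx => ?_⟩
  have hev : ∀ k, ∀ᶠ n in atTop, (mAt i (x n) < k ↔ 0 < ξ.1 (branchAt i k)) := fun k => by
    simpa only [mAt_lt_iff hq] using eventually_horoFun_pos_iff hx (branchAt i k)
  refine tendsto_order.2 ⟨fun a ha => ?_, fun a ha => ?_⟩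
  · simp only [lt_iSup_iff] at ha
    obtain ⟨k, hk, hak⟩ := ha
    filter_upwards [hev k] with n hn
    exact hak.trans_le (by exact_mod_cast not_lt.1 (mt hn.1 hk))
  · obtain ⟨N, hN⟩ := ENat.ne_top_iff_exists.1 ha.ne_top
    have hpos : 0 < ξ.1 (branchAt i (N + 1)) := by
      by_contra hneg
      have := le_iSup₂ (f := fun (k : ℕ) (_ : ¬ 0 < ξ.1 (branchAt i k)) => (k : ℕ∞)) (N + 1) hneg
      rw [← hN] at this
      have := Nat.cast_le.1 this
      omega
    filter_upwards [hev (N + 1)] with n hn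
    refine lt_of_le_of_lt ?_ ha
    rw [← hN]
    exact_mod_cast Nat.lt_succ_iff.1 (hn.2 hpos)

theorem IsLimitM.unique {i : Fin 3} {ξ : HoroClosure (base : DL 3 q)} {L L' : ℕ∞}
    (h1 : IsLimitM i ξ L) (h2 : IsLimitM i ξ L') : L = L' := by
  obtain ⟨x, hx⟩ := exists_seq_tendsto ξ
  exact tendsto_nhds_unique (h1 x hx) (h2 x hx)

theorem isLimitM_of_tendsto (hq : 2 ≤ q) {i : Fin 3} {ξ : HoroClosure (base : DL 3 q)} {L : ℕ∞}
    {x : ℕ → DL 3 q} (hx : Tendsto (fun n => horoEmbed base (x n)) atTop (𝓝 ξ))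
    (hL : Tendsto (fun n => (mAt i (x n) : ℕ∞)) atTop (𝓝 L)) : IsLimitM i ξ L := by
  obtain ⟨L', hL'⟩ := exists_isLimitM hq i ξ
  rwa [tendsto_nhds_unique hL (hL' x hx)]

/-- A limit of points with unbounded `m_i` is a boundary point. -/
theorem mem_horoBoundary_of_tendsto (hq : 2 ≤ q) {i : Fin 3} {ξ : HoroClosure (base : DL 3 q)}
    {x : ℕ → DL 3 q} (hx : Tendsto (fun n => horoEmbed base (x n)) atTop (𝓝 ξ))
    (hm : Tendsto (fun n => mAt i (x n)) atTop atTop) : ξ ∈ horoBoundary (base : DL 3 q) := by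
  rintro ⟨y, rfl⟩
  -- Were the limit a vertex `y`, then `m_i(x_n) ≤ m_i(y)` would hold eventually.
  have h1 := eventually_horoFun_pos_iff hx (branchAt i (mAt i y + 1))
  obtain ⟨n, hn, hn'⟩ := (h1.and (hm.eventually_ge_atTop (mAt i y + 1))).exists
  have h2 : 0 < horoFun base y (branchAt i (mAt i y + 1)) :=
    (mAt_lt_iff hq _ _ _).1 (Nat.lt_succ_self _)
  exact not_lt.2 hn' ((mAt_lt_iff hq _ _ _).2 (hn.2 h2))

/-- A sequence converges in the horofunction bordification if eventually the distances to all
points have the same increments. -/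
theorem exists_tendsto_horoEmbed (x : ℕ → DL 3 q) (K : ℤ)
    (hx : ∀ z, ∃ N, ∀ n ≥ N,
      ((graph 3 q).dist z (x (n + 1)) : ℤ) = (graph 3 q).dist z (x n) + K) :
    ∃ ξ : HoroClosure (base : DL 3 q), Tendsto (fun n => horoEmbed base (x n)) atTop (𝓝 ξ) := by
  have key : ∀ z, ∃ N, ∀ n ≥ N, horoFun base (x n) z = horoFun base (x N) z := by
    intro z
    obtain ⟨N₁, h1⟩ := hx z
    obtain ⟨N₂, h2⟩ := hx base
    refine ⟨max N₁ N₂, fun n hn => ?_⟩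
    induction n, hn using Nat.le_induction with
    | base => rfl
    | succ n hn ih =>
      rw [← ih, horoFun_apply, horoFun_apply]
      have e1 := h1 n (le_of_max_le_left hn)
      have e2 := h2 n (le_of_max_le_right hn)
      have : ((graph 3 q).dist z (x (n + 1)) : ℤ) - (graph 3 q).dist base (x (n + 1)) =
        (graph 3 q).dist z (x n) - (graph 3 q).dist base (x n) := by omega
      exact_mod_cast this
  choose N hN using key
  let g : C(DL 3 q, ℝ) := ⟨fun z => horoFun base (x (N z)) z, continuous_of_discreteTopology⟩
  have hg : Tendsto (fun n => horoFun base (x n)) atTop (𝓝 g) := by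
    -- On a discrete space the compact-open topology is that of pointwise convergence.
    rw [ContinuousMap.isHomeomorph_coe.isInducing.tendsto_nhds_iff, tendsto_pi_nhds]
    intro z
    refine tendsto_const_nhds.congr' ?_
    filter_upwards [eventually_ge_atTop (N z)] with n hn
    exact (hN z n hn).symm
  exact ⟨⟨g, mem_closure_of_tendsto hg (Eventually.of_forall fun n => ⟨_, rfl⟩)⟩,
    tendsto_subtype_rng.2 hg⟩

theorem forall_distinct {i j k : Fin 3} (hij : i ≠ j) (hik : i ≠ k) (hjk : j ≠ k)
    {P : Fin 3 → Fin 3 → Fin 3 → Prop} (h1 : P i j k) (h2 : P i k j) (h3 : P j i k)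
    (h4 : P j k i) (h5 : P k i j) (h6 : P k j i) (a b c : Fin 3) (hab : a ≠ b) (hac : a ≠ c)
    (hbc : b ≠ c) : P a b c := by
  rcases eq_or_eq_or_eq hij hik hjk a with rfl | rfl | rfl <;>
    rcases eq_or_eq_or_eq hij hik hjk b with rfl | rfl | rfl <;>
    rcases eq_or_eq_or_eq hij hik hjk c with rfl | rfl | rfl <;> first | assumption | contradiction

/-! ### The sequences `α_n` and `β_n` -/

theorem proj_alphaSeq_zero (n : ℕ) : proj 0 (alphaSeq q n) = (succ 1)^[n] TreeVertex.base := rfl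

theorem proj_alphaSeq_one (n : ℕ) : proj 1 (alphaSeq q n) = pred^[n] TreeVertex.base := rfl

theorem proj_alphaSeq_two (n : ℕ) : proj 2 (alphaSeq q n) = TreeVertex.base := rfl

theorem proj_betaSeq_zero (n : ℕ) : proj 0 (betaSeq q n) = TreeVertex.base := rfl

theorem proj_betaSeq_one (n : ℕ) : proj 1 (betaSeq q n) = TreeVertex.base := rfl

theorem proj_betaSeq_two (n : ℕ) : proj 2 (betaSeq q n) = branch q n := rfl

theorem alphaSeq_adj (n : ℕ) : (graph 3 q).Adj (alphaSeq q n) (alphaSeq q (n + 1)) := by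
  refine ⟨0, 1, by decide, Or.inr ?_, Or.inl ?_, fun k h0 h1 => ?_⟩
  · rw [proj_alphaSeq_zero, proj_alphaSeq_zero, Function.iterate_succ_apply', pred_succ]
  · rw [proj_alphaSeq_one, proj_alphaSeq_one, Function.iterate_succ_apply']
  · obtain rfl : k = 2 := by omega
    rfl

theorem height_iterate_succ_base (a : Fin q) (n : ℕ) :
    ((succ a)^[n] TreeVertex.base).height = n := by
  rw [height_iterate_succ, height_base, zero_add]

theorem height_iterate_pred_base (n : ℕ) :
    (pred^[n] (TreeVertex.base : TreeVertex q)).height = -n := by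
  rw [height_iterate_pred, height_base, zero_sub]

theorem dist_alphaSeq_succ (z : DL 3 q) : ∃ N, ∀ n ≥ N,
    ((graph 3 q).dist z (alphaSeq q (n + 1)) : ℤ) = (graph 3 q).dist z (alphaSeq q n) + 1 := by
  -- The first two terms make the common ancestors in trees 0 and 1 stable and equal to `pred^[n]
  -- base`, respectively. The third gives `m 2 + l 2 ≤ m 1`, so that the growing sum attains the
  -- maximum in tours with tree 2 in the middle.
  refine ⟨(proj 0 z).height.toNat + (-(TreeVertex.base ⊓ proj 1 z).height).toNat +
    ((proj 2 z).height - 2 * (proj 2 z ⊓ TreeVertex.base).height - (proj 1 z).height).toNat,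
    fun n hn => le_antisymm ?_ ?_⟩
  · have h1 := connected.dist_triangle (u := z) (v := alphaSeq q n) (w := alphaSeq q (n + 1))
    have h2 := SimpleGraph.dist_eq_one_iff_adj.2 (alphaSeq_adj (q := q) n)
    omega
  · have e0 : proj 0 z ⊓ (succ 1)^[n + 1] TreeVertex.base =
        proj 0 z ⊓ (succ 1)^[n] TreeVertex.base :=
      inf_iterate_succ_succ _ _ _ _ (by rw [height_base]; omega)
    have e1 := height_base_inf_iterate_pred n (proj 1 z) (by omega)
    have e1' := height_base_inf_iterate_pred (n + 1) (proj 1 z) (by push_cast; omega)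
    have g0 := height_inf_le_left (proj 0 z) ((succ 1)^[n] TreeVertex.base)
    have g2 := height_inf_le_left (proj 2 z) TreeVertex.base
    refine dist_add_le_dist (fun i => rfl) (fun i => rfl)
      (forall_distinct (i := 0) (j := 1) (k := 2) (by decide) (by decide) (by decide)
        ?_ ?_ ?_ ?_ ?_ ?_) <;>
      simp only [tourLength, proj_alphaSeq_zero, proj_alphaSeq_one, proj_alphaSeq_two, e0, e1, e1',
        height_iterate_succ_base, height_iterate_pred_base, height_base] <;>
      push_cast <;> omega

theorem height_inf_branch (hq : 2 ≤ q) {n : ℕ} {v : TreeVertex q}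
    (hn : -(n : ℤ) < (TreeVertex.base ⊓ v).height) : (v ⊓ branch q n).height = -n := by
  have hb := height_base_inf_branch (q := q) hq n
  rw [inf_comm, ← hb, inf_comm TreeVertex.base (branch q n)]
  refine height_inf_of_lt _ _ _ ?_
  rwa [inf_comm (branch q n), hb]

theorem dist_betaSeq_succ (hq : 2 ≤ q) (z : DL 3 q) : ∃ N, ∀ n ≥ N,
    ((graph 3 q).dist z (betaSeq q (n + 1)) : ℤ) = (graph 3 q).dist z (betaSeq q n) + 2 := by
  -- The first line puts the branching point of `β_n` strictly below that of `z`. The second and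
  -- third give `m 0 + m 1 ≤ l 2`, for tours with tree 2 in the middle; the last two give `m i + l i
  -- ≤ m 2`, for tours with tree `i` in the middle. Hence each maximum stays on one branch.
  refine ⟨(-(TreeVertex.base ⊓ proj 2 z).height).toNat + 1 +
    ((proj 0 z).height - (proj 0 z ⊓ TreeVertex.base).height).toNat +
    ((proj 1 z).height - (proj 1 z ⊓ TreeVertex.base).height).toNat +
    ((proj 0 z).height - 2 * (proj 0 z ⊓ TreeVertex.base).height - (proj 2 z).height).toNat +
    ((proj 1 z).height - 2 * (proj 1 z ⊓ TreeVertex.base).height - (proj 2 z).height).toNat,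
    fun n hn => ?_⟩
  have e2 := height_inf_branch hq (n := n) (v := proj 2 z) (by omega)
  have e2' := height_inf_branch hq (n := n + 1) (v := proj 2 z) (by push_cast; omega)
  have key : ∀ a b c : Fin 3, a ≠ b → a ≠ c → b ≠ c →
      tourLength (fun i => (proj i z).height - (proj i z ⊓ proj i (betaSeq q (n + 1))).height)
        (fun i => (proj i (betaSeq q (n + 1))).height -
          (proj i z ⊓ proj i (betaSeq q (n + 1))).height) a b c =
      tourLength (fun i => (proj i z).height - (proj i z ⊓ proj i (betaSeq q n)).height)
        (fun i => (proj i (betaSeq q n)).height -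
          (proj i z ⊓ proj i (betaSeq q n)).height) a b c + 2 := by
    have g0 := height_inf_le_left (proj 0 z) TreeVertex.base
    have g1 := height_inf_le_left (proj 1 z) TreeVertex.base
    refine forall_distinct (i := 0) (j := 1) (k := 2) (by decide) (by decide) (by decide)
        ?_ ?_ ?_ ?_ ?_ ?_ <;>
      simp only [tourLength, proj_betaSeq_zero, proj_betaSeq_one, proj_betaSeq_two, e2, e2',
        height_branch, height_base] <;>
      push_cast <;> omega
  refine le_antisymm ?_ ?_
  · have := dist_add_le_dist (v := z) (w := betaSeq q (n + 1)) (v' := z) (w' := betaSeq q n)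
      (K := -2) (fun i => rfl) (fun i => rfl)
      fun a b c hab hac hbc => (by have := key a b c hab hac hbc; omega)
    rw [← sub_eq_add_neg, sub_le_iff_le_add] at this
    exact this
  · exact dist_add_le_dist (fun i => rfl) (fun i => rfl)
      fun a b c hab hac hbc => (key a b c hab hac hbc).ge

theorem two_mul_le_dist_betaSeq (hq : 2 ≤ q) (n : ℕ) :
    2 * n ≤ (graph 3 q).dist base (betaSeq q n) := by
  have e2 := height_base_inf_branch (q := q) hq n
  have key : ((graph 3 q).dist base base : ℤ) + 2 * n ≤ (graph 3 q).dist base (betaSeq q n) := by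
    refine dist_add_le_dist (fun i => rfl) (fun i => rfl)
      (forall_distinct (i := 0) (j := 1) (k := 2) (by decide) (by decide) (by decide)
        ?_ ?_ ?_ ?_ ?_ ?_) <;>
      simp only [tourLength, proj_betaSeq_zero, proj_betaSeq_one, proj_betaSeq_two, e2,
        height_branch, height_base, proj_base, inf_idem] <;>
      omega
  rw [SimpleGraph.dist_self] at key
  push_cast at key
  omega

theorem mAt_two_alphaSeq (n : ℕ) : mAt 2 (alphaSeq q n) = 0 := by
  have : (mAt 2 (alphaSeq q n) : ℤ) = -(TreeVertex.base ⊓ TreeVertex.base).height := natCast_m _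
  rw [inf_idem, height_base] at this
  omega

theorem mAt_one_alphaSeq (n : ℕ) : mAt 1 (alphaSeq q n) = n := by
  have h1 : (mAt 1 (alphaSeq q n) : ℤ) =
      -(TreeVertex.base ⊓ pred^[n] TreeVertex.base).height := natCast_m _
  rw [height_base_inf_iterate_pred n _ (by rw [inf_idem, height_base]; omega)] at h1
  omega

theorem mAt_betaSeq_of_ne {i : Fin 3} (hi : i ≠ 2) (n : ℕ) : mAt i (betaSeq q n) = 0 := by
  have h1 : proj i (betaSeq q n) = TreeVertex.base := by
    rcases eq_or_eq_or_eq (a := 0) (b := 1) (c := 2) (by decide) (by decide) (by decide) i with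
      rfl | rfl | rfl
    · rfl
    · rfl
    · exact absurd rfl hi
  have : (mAt i (betaSeq q n) : ℤ) = -(TreeVertex.base ⊓ proj i (betaSeq q n)).height := natCast_m _
  rw [h1, inf_idem, height_base] at this
  omega

theorem mAt_two_betaSeq (hq : 2 ≤ q) (n : ℕ) : mAt 2 (betaSeq q n) = n := by
  have : (mAt 2 (betaSeq q n) : ℤ) = -(TreeVertex.base ⊓ branch q n).height := natCast_m _
  rw [height_base_inf_branch hq] at this
  omega

/-- Tree 2 descends `n` edges while tree 0 climbs, then climbs back while tree 1 descends; no move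
is wasted. -/
theorem dist_betaSeq_alphaSeq_le (n : ℕ) :
    (graph 3 q).dist (betaSeq q n) (alphaSeq q n) ≤ 2 * n := by
  have hp : pred^[n] TreeVertex.base ≤ (TreeVertex.base : TreeVertex q) := ⟨n, rfl⟩
  have key := dist_le_tourLength (a := 0) (b := 2) (c := 1) (by decide) (by decide) (by decide)
    (betaSeq q n) (alphaSeq q n)
    ![TreeVertex.base, pred^[n] TreeVertex.base, pred^[n] TreeVertex.base] (fun i => by
      fin_cases i
      · exact le_rfl
      · exact hp
      · exact le_iterate_succ _ _ _) (fun i => by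
      fin_cases i
      · exact le_iterate_succ _ _ _
      · exact le_rfl
      · exact hp)
  simp [tourLength, proj_betaSeq_zero, proj_betaSeq_one, proj_betaSeq_two,
    proj_alphaSeq_one, proj_alphaSeq_two, height_branch, height_base,
    height_iterate_pred_base] at key
  omega

/-! ### Neighbourhoods of `β` -/

/-- Near `β`, moving up in a tree `i ≠ 2` brings one closer. -/
theorem dist_betaSeq_lt (hq : 2 ≤ q) {i j : Fin 3} (hij : i ≠ j) (hi : i ≠ 2) (hj : j ≠ 2)
    {y : DL 3 q} {a : Fin q} (y2 : proj 2 y = pred TreeVertex.base)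
    (yi : proj i y = succ a TreeVertex.base) (yj : proj j y = TreeVertex.base) {n : ℕ}
    (hn : 1 ≤ n) :
    (graph 3 q).dist y (betaSeq q n) < (graph 3 q).dist base (betaSeq q n) := by
  have hlow := two_mul_le_dist_betaSeq hq n
  have hb : ∀ k : Fin 3, k ≠ 2 → proj k (betaSeq q n) = TreeVertex.base := fun k hk => by
    rcases eq_or_eq_or_eq (a := 0) (b := 1) (c := 2) (by decide) (by decide) (by decide) k with
      rfl | rfl | rfl
    · rfl
    · rfl
    · exact absurd rfl hk
  have hbi := hb i hi
  have hbj := hb j hj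
  -- With tree 2 in the middle, the first step down in tree 2 is saved, and the extra edge in tree
  -- `i` pays for a step of the climb in tree 2: the tour has length `2 * n - 1`.
  have key := dist_le_tourLength (a := j) (b := 2) (c := i) hj hij.symm hi.symm y (betaSeq q n)
    (fun k => if k = 2 then pred^[n] TreeVertex.base else TreeVertex.base) (fun k => by
      rcases eq_or_eq_or_eq hij hi hj k with rfl | rfl | rfl
      · rw [if_neg hi, yi]
        exact le_iterate_succ a 1 _
      · rw [if_neg hj, yj]
      · rw [if_pos rfl, y2]
        exact ⟨n - 1, by rw [← Function.iterate_succ_apply, Nat.succ_eq_add_one,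
          Nat.sub_add_cancel hn]⟩) (fun k => by
      rcases eq_or_eq_or_eq hij hi hj k with rfl | rfl | rfl
      · rw [if_neg hi, hbi]
      · rw [if_neg hj, hbj]
      · rw [if_pos rfl]
        exact le_iterate_succ _ _ _)
  simp only [tourLength, if_neg hi, if_neg hj, if_true, hbi, yi, yj, y2, proj_betaSeq_two,
    height_branch, height_pred, height_base, height_iterate_pred_base,
    show (succ a TreeVertex.base).height = 0 + 1 from rfl] at key
  omega

/-- If moving up in a tree `i ≠ 2` brings one closer to `x`, whatever the label of the edge, then
`x` has trivial coordinate `i`. -/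
theorem proj_eq_base_of_dist_lt (hq : 2 ≤ q) {i j : Fin 3} (hij : i ≠ j) (hi : i ≠ 2)
    (hj : j ≠ 2) {x : DL 3 q} (mi : mAt i x = 0) (mj : mAt j x = 0) (m2 : 0 < mAt 2 x)
    {y : Fin q → DL 3 q} (y2 : ∀ a, proj 2 (y a) = pred TreeVertex.base)
    (yi : ∀ a, proj i (y a) = succ a TreeVertex.base) (yj : ∀ a, proj j (y a) = TreeVertex.base)
    (hy : ∀ a, (graph 3 q).dist (y a) x < (graph 3 q).dist base x) :
    proj i x = TreeVertex.base := by
  have bi : TreeVertex.base ≤ proj i x := base_le_of_m_eq_zero mi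
  have bj : TreeVertex.base ≤ proj j x := base_le_of_m_eq_zero mj
  have hj0 := height_mono bj
  rw [height_base] at hj0
  have hm : (mAt 2 x : ℤ) = -(TreeVertex.base ⊓ proj 2 x).height := natCast_m _
  by_contra hne
  have hpos : 0 < (proj i x).height := by
    by_contra hle
    exact hne (eq_base_of_le bi (not_lt.1 hle))
  -- At most one successor of the base point is an ancestor of `proj i x`, and there are at least
  -- two labels.
  obtain ⟨a, ha⟩ : ∃ a : Fin q, ¬ succ a TreeVertex.base ≤ proj i x := by
    by_contra! hall
    have h1 := succ_injective_label <|
      eq_of_le_of_height_le (le_of_height_le (hall 0) (hall 1) le_rfl) le_rfl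
    have h2 : (0 : Fin q).val = (1 : Fin q).val := congrArg Fin.val h1
    rw [Fin.val_zero, Fin.val_one', Nat.mod_eq_of_lt hq] at h2
    omega
  have gi : (succ a TreeVertex.base ⊓ proj i x).height = 0 := by
    have h1 := (height_inf_succ_le TreeVertex.base (proj i x) a).resolve_right ha
    have h2 := height_mono (le_inf (le_iterate_succ a 1 TreeVertex.base) bi)
    rw [inf_eq_left.2 bi, height_base] at h1
    rw [height_base] at h2
    exact le_antisymm h1 h2
  -- Since `m_2(x) > 0`, the step down in tree 2 leads towards `x` and keeps the common ancestor.
  have g2 : (pred TreeVertex.base ⊓ proj 2 x).height = -mAt 2 x := by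
    have hlt : TreeVertex.base ⊓ proj 2 x < TreeVertex.base :=
      lt_of_le_of_ne inf_le_left fun he => by
        rw [he, height_base] at hm
        omega
    have h1 := height_mono (le_inf (le_pred_of_lt hlt) inf_le_right)
    have h2 := height_mono (inf_le_inf_right (proj 2 x) (pred_le TreeVertex.base))
    omega
  have s := sum_height hij hi hj x
  have h2 := height_inf_le_right TreeVertex.base (proj 2 x)
  -- This tour bounds the distance from the base point by `l 2 + m 2`. From `y a`, the edge in the
  -- wrong direction in tree `i` cancels the step gained in tree 2, and `proj i x` has positive
  -- height, so none of the six tours is shorter than that.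
  have hup := dist_le_tourLength hij hi hj base x (fun k => TreeVertex.base ⊓ proj k x)
    (fun k => inf_le_left) (fun k => inf_le_right)
  obtain ⟨b, c, d, hbc, hbd, hcd, hlow⟩ := exists_tourLength_le_dist (y a) x
  have hlt := hy a
  revert hlow
  refine forall_distinct hij hi hj (P := fun b c d => ¬ tourLength _ _ b c d ≤ _)
    ?_ ?_ ?_ ?_ ?_ ?_ b c d hbc hbd hcd <;>
  · simp only [tourLength, y2, yi, yj, gi, g2, proj_base, inf_eq_left.2 bi, inf_eq_left.2 bj,
      height_pred, height_base, show (succ a TreeVertex.base).height = 0 + 1 from rfl] at hup ⊢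
    omega

/-- A neighbourhood of the limit of `(β_n)` meets the graph only in points of the form `(o, o, v)`
with large `m(v)`. -/
theorem eventually_nhds_lim_betaSeq (hq : 2 ≤ q) {β : HoroClosure (base : DL 3 q)}
    (hβ : Tendsto (fun n => horoEmbed base (betaSeq q n)) atTop (𝓝 β)) {k : ℕ} (hk : 1 ≤ k) :
    ∀ᶠ ξ in 𝓝 β, ∀ x, horoEmbed base x = ξ →
      proj 0 x = TreeVertex.base ∧ proj 1 x = TreeVertex.base ∧ k ≤ mAt 2 x := by
  have hup : ∀ i : Fin 3, i ≠ 2 → ∃ y : Fin q → DL 3 q, ∀ a, proj 2 (y a) = pred TreeVertex.base ∧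
      proj i (y a) = succ a TreeVertex.base ∧
      ∀ j, j ≠ 2 → j ≠ i → proj j (y a) = TreeVertex.base := by
    intro i hi
    choose y hy using fun a : Fin q => exists_dist_le hi.symm 1 base (succ a TreeVertex.base)
      (pred_succ a TreeVertex.base)
    exact ⟨y, fun a => (hy a).2⟩
  -- The finitely many open conditions `ξ (y a) < 0`, one for each label `a`, hold at `β` and force
  -- coordinate `i` to be trivial.
  have hneg : ∀ i j : Fin 3, i ≠ j → i ≠ 2 → j ≠ 2 → ∀ᶠ ξ in 𝓝 β, ∀ x, horoEmbed base x = ξ →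
      mAt i x = 0 → mAt j x = 0 → 0 < mAt 2 x → proj i x = TreeVertex.base := by
    intro i j hij hi hj
    obtain ⟨y, hy⟩ := hup i hi
    have hβy : ∀ a, β.1 (y a) < 0 := fun a => by
      refine lt_of_le_of_lt (le_of_tendsto (tendsto_horoFun hβ (y a)) ?_) neg_one_lt_zero
      filter_upwards [eventually_ge_atTop 1] with n hn
      exact horoFun_le_neg_one <| horoFun_neg_iff.2 <|
        dist_betaSeq_lt hq hij hi hj (hy a).1 (hy a).2.1 ((hy a).2.2 j hj hij.symm) hn
    have hev : ∀ᶠ ξ in 𝓝 β, ∀ a, ξ.1 (y a) < 0 := eventually_all.2 fun a =>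
      ((continuous_eval (y a)).tendsto β).eventually_lt_const (hβy a)
    filter_upwards [hev] with ξ hξ x hx mi mj m2
    subst hx
    exact proj_eq_base_of_dist_lt hq hij hi hj mi mj m2 (fun a => (hy a).1)
      (fun a => (hy a).2.1) (fun a => (hy a).2.2 j hj hij.symm)
      fun a => horoFun_neg_iff.1 (hξ a)
  have hzero : ∀ i : Fin 3, i ≠ 2 → ∀ᶠ ξ in 𝓝 β, ∀ x, horoEmbed base x = ξ → mAt i x = 0 := by
    intro i hi
    have hpos : 0 < β.1 (branchAt i 1) := by
      obtain ⟨n, hn⟩ := (eventually_horoFun_pos_iff hβ (branchAt i 1)).exists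
      refine hn.1 ((mAt_lt_iff hq i 1 _).1 ?_)
      rw [mAt_betaSeq_of_ne hi]
      exact one_pos
    filter_upwards [((continuous_eval (branchAt i 1)).tendsto β).eventually_const_lt hpos]
      with ξ hξ x hx
    subst hx
    exact Nat.lt_one_iff.1 ((mAt_lt_iff hq i 1 x).2 hξ)
  have hlarge : ∀ᶠ ξ in 𝓝 β, ∀ x, horoEmbed base x = ξ → k ≤ mAt 2 x := by
    have hle : β.1 (branchAt 2 k) < 1 := by
      obtain ⟨n, hn, hkn⟩ := ((eventually_horoFun_pos_iff hβ (branchAt 2 k)).and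
        (eventually_ge_atTop k)).exists
      rw [← mAt_lt_iff hq, mAt_two_betaSeq hq] at hn
      exact lt_of_le_of_lt (not_lt.1 (mt hn.2 (not_lt.2 hkn))) one_pos
    filter_upwards [((continuous_eval (branchAt 2 k)).tendsto β).eventually_lt_const hle]
      with ξ hξ x hx
    subst hx
    exact not_lt.1 (mt (mAt_lt_iff hq 2 k x).1 (horoFun_lt_one_iff.1 hξ))
  filter_upwards [hneg 0 1 (by decide) (by decide) (by decide),
    hneg 1 0 (by decide) (by decide) (by decide), hzero 0 (by decide), hzero 1 (by decide),
    hlarge] with ξ h0 h1 m0 m1 m2 x hx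
  have hm2 : 0 < mAt 2 x := lt_of_lt_of_le hk (m2 x hx)
  exact ⟨h0 x hx (m0 x hx) (m1 x hx) hm2, h1 x hx (m1 x hx) (m0 x hx) hm2, m2 x hx⟩

/-! ### The stars of `α` and `β` -/

/-- The third coordinate of `z` lies above the base point, so its common ancestor with that of `x`
is where `x` branches off, at height `-m_2(x)` instead of `0`. All heights of `x` are those of the
base point. -/
theorem dist_base_add_le_dist {x z : DL 3 q} (hx0 : proj 0 x = TreeVertex.base)
    (hx1 : proj 1 x = TreeVertex.base) (hz : mAt 2 z = 0) :
    (graph 3 q).dist z base + mAt 2 x ≤ (graph 3 q).dist z x := by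
  have hb := base_le_of_m_eq_zero hz
  have hm : (mAt 2 x : ℤ) = -(TreeVertex.base ⊓ proj 2 x).height := natCast_m _
  have hx2 : (proj 2 x).height = 0 := by
    have := sum_height (a := 0) (b := 1) (c := 2) (by decide) (by decide) (by decide) x
    rw [hx0, hx1, height_base] at this
    omega
  have hzb : (proj 2 z ⊓ TreeVertex.base).height = 0 := by
    rw [inf_eq_right.2 hb, height_base]
  have hzx : (proj 2 z ⊓ proj 2 x).height = -mAt 2 x := by
    rcases Nat.eq_zero_or_pos (mAt 2 x) with h0 | hpos
    · rw [eq_base_of_le (base_le_of_m_eq_zero h0) hx2.le, hzb, h0]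
      rfl
    · rw [inf_comm, height_inf_of_lt (proj 2 x) TreeVertex.base (proj 2 z)]
      · rw [inf_comm]
        omega
      · rw [inf_comm, inf_comm TreeVertex.base (proj 2 z)]
        omega
  have key := dist_add_le_dist_of_height_inf (v := z) (w := base) (v' := z) (w' := x)
    (K := mAt 2 x) 2 (fun _ => rfl) (fun i => ?_) (fun i => ?_) (by rw [proj_base]; omega)
  · exact_mod_cast key
  all_goals
    rcases eq_or_eq_or_eq (a := 0) (b := 1) (c := 2) (by decide) (by decide) (by decide) i with
      rfl | rfl | rfl
  · rw [hx0, proj_base]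
  · rw [hx1, proj_base]
  · rw [hx2, proj_base, height_base]
  · rw [hx0, proj_base]
  · rw [hx1, proj_base]
  · rw [hzx, proj_base, hzb]
    omega

theorem notMem_karlssonStar_of_isLimitM (hq : 2 ≤ q) {β ξ : HoroClosure (base : DL 3 q)}
    (hβ : Tendsto (fun n => horoEmbed base (betaSeq q n)) atTop (𝓝 β)) (hξ : IsLimitM 2 ξ 0) :
    ξ ∉ karlssonStar (horoEmbed base) base β := by
  intro hmem
  -- This open set contains `ξ`, and its vertices are those with `m_2 = 0`. It absorbs both the
  -- outer closure of the star and the closures of the halfspaces.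
  have hV : IsOpen {η : HoroClosure (base : DL 3 q) | 0 < η.1 (branchAt 2 1)} :=
    isOpen_lt continuous_const (continuous_eval _)
  have hξV : 0 < ξ.1 (branchAt 2 1) := by
    obtain ⟨x, hx⟩ := exists_seq_tendsto ξ
    obtain ⟨n, hn, hn'⟩ := ((eventually_horoFun_pos_iff hx (branchAt 2 1)).and
      ((hξ x hx).eventually_lt_const one_pos)).exists
    exact hn.1 ((mAt_lt_iff hq 2 1 _).1 (by exact_mod_cast hn'))
  obtain ⟨η, hηV, hη⟩ := mem_closure_iff.1 hmem _ hV hξV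
  simp only [Set.mem_iUnion, Set.mem_iInter] at hη
  obtain ⟨C, hC, hη⟩ := hη
  obtain ⟨k, hk⟩ := exists_nat_gt C
  have hk1 : 1 ≤ k := by
    have : (0 : ℝ) < k := hC.trans_lt hk
    exact_mod_cast this
  obtain ⟨_, hzV, z, hz, rfl⟩ := mem_closure_iff.1
    (hη _ (eventually_nhds_lim_betaSeq hq hβ hk1)) _ hV hηV
  have hz0 : mAt 2 z = 0 := Nat.lt_one_iff.1 ((mAt_lt_iff hq 2 1 z).2 hzV)
  -- All vertices of the chosen neighbourhood of `β` have distance at least `dist z base + k` from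
  -- `z`, whereas `z` lies in its halfspace with constant `C < k`.
  have hle : ENNReal.ofReal (dist z base + k) ≤ ENNReal.ofReal (dist z base + C) := by
    refine le_trans (Metric.le_infEDist.2 fun x hx => ?_) hz
    obtain ⟨h0, h1, h2⟩ := hx x rfl
    rw [edist_dist]
    refine ENNReal.ofReal_le_ofReal ?_
    have h3 := dist_base_add_le_dist h0 h1 hz0
    rw [dist_eq, dist_eq]
    exact_mod_cast (Nat.add_le_add_left h2 _).trans h3
  rw [ENNReal.ofReal_le_ofReal_iff (by positivity)] at hle
  linarith

/-- Every neighbourhood of `α` contains `α_n` for large `n`, and `β_n` is no farther from `α_n` than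
from the base point; `C = 0` suffices. -/
theorem mem_karlssonStar_of_tendsto (hq : 2 ≤ q) {α β : HoroClosure (base : DL 3 q)}
    (hα : Tendsto (fun n => horoEmbed base (alphaSeq q n)) atTop (𝓝 α))
    (hβ : Tendsto (fun n => horoEmbed base (betaSeq q n)) atTop (𝓝 β)) :
    β ∈ karlssonStar (horoEmbed base) base α := by
  refine subset_closure (Set.mem_iUnion₂.2 ⟨0, le_rfl, Set.mem_iInter₂.2 fun U hU => ?_⟩)
  refine mem_closure_of_tendsto hβ ?_
  filter_upwards [hα hU] with n hn
  refine ⟨betaSeq q n, ?_, rfl⟩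
  refine (Metric.infEDist_le_edist_of_mem
    (show alphaSeq q n ∈ horoEmbed base ⁻¹' U from hn)).trans ?_
  rw [edist_dist]
  refine ENNReal.ofReal_le_ofReal ?_
  rw [add_zero, dist_eq, dist_eq, SimpleGraph.dist_comm (v := base)]
  exact_mod_cast (dist_betaSeq_alphaSeq_le n).trans (two_mul_le_dist_betaSeq hq n)

end DL

theorem mainTheorem1 (q : ℕ) [NeZero q] (hq : 2 ≤ q) :
    (∀ h ∈ horoBoundary (DL.base : DL 3 q), ∀ i : Fin 3, ∃! L : ℕ∞, DL.IsLimitM i h L) ∧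
    ∃ α ∈ horoBoundary (DL.base : DL 3 q), ∃ β ∈ horoBoundary (DL.base : DL 3 q),
      Tendsto (fun n => horoEmbed DL.base (DL.alphaSeq q n)) atTop (𝓝 α) ∧
      Tendsto (fun n => horoEmbed DL.base (DL.betaSeq q n)) atTop (𝓝 β) ∧
      (∀ h ∈ horoBoundary (DL.base : DL 3 q), DL.IsLimitM 2 h 0 →
        h ∉ karlssonStar (horoEmbed DL.base) DL.base β) ∧
      α ∉ karlssonStar (horoEmbed DL.base) DL.base β ∧
      β ∈ karlssonStar (horoEmbed DL.base) DL.base α := by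
  obtain ⟨α, hα⟩ := DL.exists_tendsto_horoEmbed (DL.alphaSeq q) 1 DL.dist_alphaSeq_succ
  obtain ⟨β, hβ⟩ := DL.exists_tendsto_horoEmbed (DL.betaSeq q) 2 (DL.dist_betaSeq_succ hq)
  refine ⟨fun h _ i => ?_, α, ?_, β, ?_, hα, hβ,
    fun h _ hh => DL.notMem_karlssonStar_of_isLimitM hq hβ hh,
    DL.notMem_karlssonStar_of_isLimitM hq hβ (DL.isLimitM_of_tendsto hq hα ?_),
    DL.mem_karlssonStar_of_tendsto hq hα hβ⟩
  · obtain ⟨L, hL⟩ := DL.exists_isLimitM hq i h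
    exact ⟨L, hL, fun L' hL' => hL'.unique hL⟩
  · refine DL.mem_horoBoundary_of_tendsto hq (i := 1) hα ?_
    simp only [DL.mAt_one_alphaSeq]
    exact tendsto_id
  · refine DL.mem_horoBoundary_of_tendsto hq (i := 2) hβ ?_
    simp only [DL.mAt_two_betaSeq hq]
    exact tendsto_id
  · simp only [DL.mAt_two_alphaSeq, Nat.cast_zero]
    exact tendsto_const_nhds
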